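/- Let $n\ge 1$, let $F=K(x_1,\dots,x_n)$ be a rational function field in $n$ variables over a field $K$, and let $v$ be any valuation on $F$. Write $vF$, $Fv$ for the value group and residue field of $(F,v)$, and $vK$, $Kv$ for those of the restriction of $v$ to $K$. Let $\rho=\dim_{\mathbb Q}\bigl(\mathbb Q\otimes_{\mathbb Z}(vF/vK)\bigr)$ be the rational rank of $vF/vK$ and $\tau=\operatorname{trdeg}(Fv|Kv)$. Then $\rho$ and $\tau$ are finite and: (1) $n\ge\rho+\tau$, the group $vF/vK$ is countable, and the field extension $Fv|Kv$ is countably generated. (2) If $n=\rho+\tau$, then the group $vF/vK$ is finitely generated and $Fv|Kv$ is a finitely generated field extension. Moreover: - if $v$ is trivial on $K$ and $\rho=1$, then $Fv$ is a simple algebraic extension of a rational function field in $\tau$ variables over $Kv$ (of $Kv$ itself if $\tau=0$), or $\tau\ge1$ and $Fv$ is a rational function field in one variable over a finitely generated field extension of $Kv$ of transcendence degree $\tau-1$; - if $n=\tau$, then $Fv$ is a rational function field in one variable over a finitely generated field extension of $Kv$ of transcendence degree $\tau-1$. (3) If $\rho=\tau=0$, then for every algebraic closure $\tilde K$ of $K$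 and every valuation $\tilde v$ on $\tilde K$ which extends the restriction of $v$ to $K$ (up to equivalence of valuations), the valued field $(\tilde K,\tilde v)$ admits an immediate extension of transcendence degree $n$, that is, an extension of valued fields of transcendence degree $n$ with the same value group and the same residue field. -/

import Mathlib

open scoped TensorProduct

universe u w g t h

namespace ValuedFunctionField


section FieldExtensions

/-- `E` is a rational function field over `k` in `m` variables: it is generated, as a field
extension of `k`, by `m` algebraically independent elements. For `m = 0` this says `E = k`. -/
def IsRationalFunctionField (k : Type u) (E : Type w) [Field k] [Field E] [Algebra k E]
    (m : ℕ) : Prop :=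
  ∃ x : Fin m → E, AlgebraicIndependent k x ∧
    IntermediateField.adjoin k (Set.range x) = (⊤ : IntermediateField k E)

/-- The field extension `E | k` is countably generated. -/
def IsCountablyGenerated (k : Type u) (E : Type w) [Field k] [Field E] [Algebra k E] : Prop :=
  ∃ S : Set E, S.Countable ∧ IntermediateField.adjoin k S = (⊤ : IntermediateField k E)

/-- `E` is a simple algebraic extension of a rational function field in `m` variables over `k`
(of `k` itself if `m = 0`). -/
def IsSimpleAlgebraicOverRational (k : Type u) (E : Type w) [Field k] [Field E] [Algebra k E]
    (m : ℕ) : Prop :=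
  ∃ k' : IntermediateField k E, IsRationalFunctionField k k' m ∧
    ∃ a : E, IsAlgebraic k' a ∧ IntermediateField.adjoin k' {a} = (⊤ : IntermediateField k' E)

/-- `E` is a rational function field in one variable over a finitely generated field extension
`k₀` of `k` of transcendence degree `m - 1`. The transcendence degree is expressed as
`trdeg (k₀ | k) + 1 = m`, so that this is impossible for `m = 0`. -/
def IsRationalOverFG (k : Type u) (E : Type w) [Field k] [Field E] [Algebra k E]
    (m : ℕ) : Prop :=
  ∃ k₀ : IntermediateField k E, k₀.FG ∧ Algebra.trdeg k k₀ + 1 = (m : Cardinal) ∧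
    IsRationalFunctionField k₀ E 1

end FieldExtensions

section Valued

variable (K : Type u) {L : Type w} {Γ : Type g} [Field K] [Field L] [Algebra K L]
  [LinearOrderedCommGroupWithZero Γ] (v : Valuation L Γ)

/-- The restriction to `K` of a valuation `v` on an extension field `L`. -/
abbrev restr : Valuation K Γ := v.comap (algebraMap K L)

instance instHasExtensionRestr : (restr K v).HasExtension v := ⟨Valuation.IsEquiv.refl⟩

/-- The value group `vL`, a subgroup of `Γˣ` (written multiplicatively). -/
abbrev valGroup : Subgroup Γˣ := MonoidWithZeroHom.valueGroup (MonoidWithZeroHom.ofClass v)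

/-- The quotient `vL / vK`. -/
abbrev ValQuot : Type g := valGroup v ⧸ (valGroup (restr K v)).subgroupOf (valGroup v)

/-- The residue field `Lv`. -/
abbrev ResField : Type w := IsLocalRing.ResidueField v.valuationSubring

/-- `K` carries the trivial valuation under the restriction of `v`. -/
def IsTrivialOn : Prop := ∀ a : K, a ≠ 0 → v (algebraMap K L a) = 1

/-- The valued field extension `(L | K, v)` is immediate: the canonical embeddings of `vK` in
`vL` and of `Kv` in `Lv` are onto. -/
def IsImmediate : Prop :=
  valGroup (restr K v) = valGroup v ∧
    Function.Surjective (algebraMap (ResField (restr K v)) (ResField v))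

end Valued

/-- The rational rank of an abelian group `A`, written multiplicatively: the dimension of the
`ℚ`-vector space `ℚ ⊗ A`. -/
noncomputable def rationalRank (A : Type g) [CommGroup A] : Cardinal.{g} :=
  Module.rank ℚ (ℚ ⊗[ℤ] Additive A)

end ValuedFunctionField

open ValuedFunctionField

/-! The proof treats one variable at a time. Call an element of an extension of `K` of algebraic
type if its value is torsion modulo `vK` and, after taking a power and scaling by `K` to value 1,
its residue is algebraic over `Kv`. Such elements are closed under products, quotients and sums that
do not drop in value.

In `K(x)` either every nonzero element is of algebraic type, and then nothing is gained in value
group or residue field up to torsion and algebraic elements, or there is a polynomial of least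
degree whose value `f` at `x` is not of algebraic type. In the second case every polynomial has an
`f`-adic expansion whose digits, the polynomials of smaller degree, are of algebraic type. By
`le_val_sum` the terms of such an expansion cannot cancel: its value is the maximum of the values of
its terms. Hence value group and residue field are generated by what the monomials `a * f ^ m`
contribute. The digits form a finite-dimensional space, so they contribute only finitely many cosets
of `vK` and a finite residue extension, and `f` contributes either one new independent value or one
transcendental residue. This is `trichotomy_of_isRationalFunctionField_one`. Induction on the number
of variables, in `abhyankar`, adds up the contributions; equality `n = ρ + τ` means that every
variable contributes exactly one.

Countability needs no induction. Elements with distinct values modulo `vK`, or with linearly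
independent residues, are linearly independent over `K`, and `F` consists of quotients of elements
of a space of countable dimension.

For the immediate extension, let `M` be the rational function field in `n` variables over `Kt`. It
contains `F`, and `F` and `Kt` are linearly disjoint over `K`, so a valuation on `M` extends both
`v` and `vt` (`exists_valuationSubring_hasExtension`). As `M` is algebraic over `F` and `ρ = τ = 0`,
values of `M` are torsion over `vK` and residues are algebraic over `Kv`. Over the algebraically
closed `Kt` both are already present (`exists_sub_lt_of_isAlgClosed`). -/

namespace ValuedFunctionField

/-! ### Residues as a total function on the field. -/

section Residue

variable {L : Type w} {Γ : Type g} [Field L] [LinearOrderedCommGroupWithZero Γ]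
  (v : Valuation L Γ)

open Classical in
/-- The residue of `y`, with value `0` where `v y > 1`. -/
noncomputable def res (y : L) : ResField v :=
  if h : v y ≤ 1 then IsLocalRing.residue v.valuationSubring ⟨y, h⟩ else 0

variable {v}

lemma res_of_le {y : L} (h : v y ≤ 1) :
    res v y = IsLocalRing.residue v.valuationSubring ⟨y, h⟩ := dif_pos h

lemma res_eq_zero_iff {y : L} (h : v y ≤ 1) : res v y = 0 ↔ v y < 1 := by
  rw [res_of_le h, IsLocalRing.residue_eq_zero_iff]
  exact Valuation.mem_maximalIdeal_iff (v := v) (a := ⟨y, h⟩)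

lemma exists_res_eq (z : ResField v) : ∃ y, v y ≤ 1 ∧ res v y = z := by
  obtain ⟨⟨y, h⟩, rfl⟩ := IsLocalRing.residue_surjective z
  exact ⟨y, h, res_of_le h⟩

@[simp] lemma res_one : res v 1 = 1 := by
  rw [res_of_le (by simp)]; exact map_one (IsLocalRing.residue v.valuationSubring)

@[simp] lemma res_zero : res v 0 = 0 := by
  rw [res_eq_zero_iff (by simp)]; simp

lemma res_add {x y : L} (hx : v x ≤ 1) (hy : v y ≤ 1) : res v (x + y) = res v x + res v y := by
  rw [res_of_le hx, res_of_le hy, res_of_le (v.map_add_le hx hy), ← map_add]; rfl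

lemma res_mul {x y : L} (hx : v x ≤ 1) (hy : v y ≤ 1) : res v (x * y) = res v x * res v y := by
  have h : v (x * y) ≤ 1 := by rw [map_mul]; exact mul_le_one' hx hy
  rw [res_of_le hx, res_of_le hy, res_of_le h, ← map_mul]; rfl

lemma res_neg {x : L} (hx : v x ≤ 1) : res v (-x) = -res v x := by
  rw [res_of_le hx, res_of_le (by rwa [Valuation.map_neg]), ← map_neg]; rfl

lemma res_sub {x y : L} (hx : v x ≤ 1) (hy : v y ≤ 1) : res v (x - y) = res v x - res v y := by
  rw [sub_eq_add_neg, res_add hx (by rwa [Valuation.map_neg]), res_neg hy, sub_eq_add_neg]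

lemma res_eq_iff {x y : L} (hx : v x ≤ 1) (hy : v y ≤ 1) :
    res v x = res v y ↔ v (x - y) < 1 := by
  rw [← sub_eq_zero, ← res_sub hx hy, res_eq_zero_iff (v.map_sub_le hx hy)]

lemma res_ne_zero {x : L} (hx : v x = 1) : res v x ≠ 0 := by
  rw [Ne, res_eq_zero_iff hx.le, hx]; exact lt_irrefl _

lemma res_pow {x : L} (hx : v x ≤ 1) (n : ℕ) : res v (x ^ n) = res v x ^ n := by
  induction n with
  | zero => simp
  | succ n ih => rw [pow_succ, pow_succ, res_mul (by rw [map_pow]; exact pow_le_one' hx n) hx, ih]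

lemma res_inv {x : L} (hx : v x = 1) : res v x⁻¹ = (res v x)⁻¹ := by
  have hx0 : x ≠ 0 := by rintro rfl; simp at hx
  refine eq_inv_of_mul_eq_one_left ?_
  rw [← res_mul (by rw [map_inv₀, hx, inv_one]) hx.le, inv_mul_cancel₀ hx0, res_one]

lemma val_sum_le {ι : Type*} (s : Finset ι) {f : ι → L} (hf : ∀ i ∈ s, v (f i) ≤ 1) :
    v (∑ i ∈ s, f i) ≤ 1 := v.map_sum_le hf

lemma res_sum {ι : Type*} (s : Finset ι) {f : ι → L} (hf : ∀ i ∈ s, v (f i) ≤ 1) :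
    res v (∑ i ∈ s, f i) = ∑ i ∈ s, res v (f i) := by
  classical
  induction s using Finset.induction_on with
  | empty => simp
  | insert a s ha ih =>
    rw [Finset.sum_insert ha, Finset.sum_insert ha,
      res_add (hf _ (by simp)) (val_sum_le s fun i hi => hf i (by simp [hi])),
      ih fun i hi => hf i (by simp [hi])]

lemma map_eq_of_sub_lt {x y : L} (h : v (x - y) < v y) : v x = v y := by
  have := Valuation.map_add_eq_of_lt_left v h
  simpa using this

lemma sub_lt_symm {x y : L} (h : v (x - y) < v y) : v (y - x) < v x := by
  rw [map_eq_of_sub_lt h, Valuation.map_sub_swap]; exact h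

variable {K : Type u} [Field K] [Algebra K L]

lemma algebraMap_res {a : K} (h : v (algebraMap K L a) ≤ 1) :
    algebraMap (ResField (restr K v)) (ResField v) (res (restr K v) a) =
      res v (algebraMap K L a) := by
  rw [res_of_le h, res_of_le (v := restr K v) h]
  rfl

lemma exists_algebraMap_res_eq (z : ResField (restr K v)) : ∃ a : K, v (algebraMap K L a) ≤ 1 ∧
    res v (algebraMap K L a) = algebraMap (ResField (restr K v)) (ResField v) z := by
  obtain ⟨a, ha, rfl⟩ := exists_res_eq z
  exact ⟨a, ha, (algebraMap_res ha).symm⟩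

lemma isAlgebraic_res_algebraMap {a : K} (h : v (algebraMap K L a) ≤ 1) :
    IsAlgebraic (ResField (restr K v)) (res v (algebraMap K L a)) := by
  rw [← algebraMap_res h]; exact isAlgebraic_algebraMap _

end Residue

/-! ### Elements of algebraic type. -/

section AlgebraicType

variable (K : Type u) {L : Type w} {Γ : Type g} [Field K] [Field L] [Algebra K L]
  [LinearOrderedCommGroupWithZero Γ] (v : Valuation L Γ)

/-- Some power of `y`, scaled to value `1` by an element of `K`, has algebraic residue over `Kv`. -/
def IsAlgType (y : L) : Prop :=
  ∃ e : ℕ, 0 < e ∧ ∃ c : K, v (y ^ e * algebraMap K L c) = 1 ∧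
    IsAlgebraic (ResField (restr K v)) (res v (y ^ e * algebraMap K L c))

variable {K v}

namespace IsAlgType

lemma ne_zero {y : L} (hy : IsAlgType K v y) : y ≠ 0 := by
  obtain ⟨e, he, c, h, -⟩ := hy
  rintro rfl
  simp [he.ne'] at h

lemma of_isAlgebraic {y : L} (hy : v y = 1) (h : IsAlgebraic (ResField (restr K v)) (res v y)) :
    IsAlgType K v y := ⟨1, one_pos, 1, by simpa using hy, by simpa using h⟩

lemma of_base {a : K} (ha : a ≠ 0) : IsAlgType K v (algebraMap K L a) := by
  have : algebraMap K L a ≠ 0 := by simpa using ha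
  refine ⟨1, one_pos, a⁻¹, ?_, ?_⟩
  · rw [pow_one, ← map_mul, mul_inv_cancel₀ ha]; simp
  · rw [pow_one, ← map_mul, mul_inv_cancel₀ ha]; simp [isAlgebraic_one]

lemma one : IsAlgType K v (1 : L) := by simpa using of_base (K := K) (v := v) one_ne_zero

lemma mul {y z : L} (hy : IsAlgType K v y) (hz : IsAlgType K v z) : IsAlgType K v (y * z) := by
  obtain ⟨e, he, c, h, ha⟩ := hy
  obtain ⟨e', he', c', h', ha'⟩ := hz
  have key : (y * z) ^ (e * e') * algebraMap K L (c ^ e' * c' ^ e) =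
      (y ^ e * algebraMap K L c) ^ e' * (z ^ e' * algebraMap K L c') ^ e := by
    simp only [map_mul, map_pow]; ring
  refine ⟨e * e', Nat.mul_pos he he', c ^ e' * c' ^ e, ?_, ?_⟩
  · rw [key, map_mul, map_pow, map_pow, h, h']; simp
  · rw [key, res_mul (by simp [map_pow, h]) (by simp [map_pow, h']), res_pow h.le, res_pow h'.le]
    exact (ha.pow _).mul (ha'.pow _)

lemma inv {y : L} (hy : IsAlgType K v y) : IsAlgType K v y⁻¹ := by
  obtain ⟨e, he, c, h, ha⟩ := hy
  have key : y⁻¹ ^ e * algebraMap K L c⁻¹ = (y ^ e * algebraMap K L c)⁻¹ := by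
    rw [map_inv₀, mul_inv, inv_pow]
  exact ⟨e, he, c⁻¹, by rw [key, map_inv₀, h, inv_one], by rw [key, res_inv h]; exact ha.inv⟩

lemma div {y z : L} (hy : IsAlgType K v y) (hz : IsAlgType K v z) : IsAlgType K v (y / z) := by
  rw [div_eq_mul_inv]; exact hy.mul hz.inv

lemma pow {y : L} (hy : IsAlgType K v y) (n : ℕ) : IsAlgType K v (y ^ n) := by
  induction n with
  | zero => simpa using one
  | succ n ih => rw [pow_succ]; exact ih.mul hy

lemma of_pow {y : L} {n : ℕ} (hn : 0 < n) (hy : IsAlgType K v (y ^ n)) : IsAlgType K v y := by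
  obtain ⟨e, he, c, h, ha⟩ := hy
  exact ⟨n * e, Nat.mul_pos hn he, c, by rwa [pow_mul], by rwa [pow_mul]⟩

/-- The quotient `z / y` has residue 1, so only the leading term matters. -/
lemma of_sub_lt {y z : L} (hy : IsAlgType K v y) (h : v (z - y) < v y) : IsAlgType K v z := by
  have hy0 := hy.ne_zero
  have h1 : v (z / y - 1) < 1 := by
    have : z / y - 1 = (z - y) / y := by field_simp
    rw [this, map_div₀]
    exact (div_lt_one₀ (zero_lt_iff.2 ((Valuation.ne_zero_iff v).2 hy0))).2 h
  have h2 : v (z / y) = 1 := by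
    simpa using map_eq_of_sub_lt (v := v) (x := z / y) (y := 1) (by simpa using h1)
  have h3 : IsAlgType K v (z / y) := by
    refine of_isAlgebraic h2 ?_
    have : res v (z / y) = res v 1 := (res_eq_iff h2.le (by simp)).2 h1
    rw [this, res_one]; exact isAlgebraic_one
  have := h3.mul hy
  rwa [div_mul_cancel₀ _ hy0] at this

lemma isAlgebraic_res {y : L} (hy : IsAlgType K v y) (h : v y ≤ 1) :
    IsAlgebraic (ResField (restr K v)) (res v y) := by
  rcases h.lt_or_eq with h | h
  · rw [(res_eq_zero_iff h.le).2 h]; exact isAlgebraic_zero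
  obtain ⟨e, he, c, hc, ha⟩ := hy
  -- Since `y` already has value 1, so does the scaling constant; its residue lies in the base and
  -- can be divided out.
  have hc1 : v (algebraMap K L c) = 1 := by
    rw [map_mul, map_pow, h, one_pow, one_mul] at hc; exact hc
  rw [res_mul (by simp [h]) hc1.le, res_pow h.le] at ha
  have h2 := ha.mul (isAlgebraic_res_algebraMap hc1.le).inv
  rw [mul_inv_cancel_right₀ (res_ne_zero hc1)] at h2
  exact IsAlgebraic.of_pow he h2

/-- If a sum of two elements of algebraic type does not drop in value, it is of algebraic type. -/
lemma add {x y : L} (hx : IsAlgType K v x ∨ x = 0) (hy : IsAlgType K v y ∨ y = 0)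
    (h0 : x + y ≠ 0) (hxv : v x ≤ v (x + y)) (hyv : v y ≤ v (x + y)) :
    IsAlgType K v (x + y) := by
  rcases hx with hx | rfl
  swap
  · simp only [zero_add] at *; exact hy.resolve_right h0
  rcases hy with hy | rfl
  swap
  · simpa using hx
  wlog hxy : v y ≤ v x generalizing x y
  · rw [add_comm] at h0 hxv hyv ⊢
    exact this h0 hyv hxv hy hx (le_of_not_ge hxy)
  have hv : v (x + y) = v x := le_antisymm (v.map_add_le le_rfl hxy) hxv
  have hx0 := hx.ne_zero
  have hvx : v x ≠ 0 := (Valuation.ne_zero_iff v).2 hx0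
  have h1 : v (y / x) ≤ 1 := by rw [map_div₀]; exact div_le_one_of_le₀ hxy zero_le
  have h2 : (x + y) / x = 1 + y / x := by field_simp
  have h3 : IsAlgType K v ((x + y) / x) := by
    refine of_isAlgebraic (by rw [map_div₀, hv, div_self hvx]) ?_
    rw [h2, res_add (by simp) h1, res_one]
    exact isAlgebraic_one.add ((hy.div hx).isAlgebraic_res h1)
  have := h3.mul hx
  rwa [div_mul_cancel₀ _ hx0] at this

end IsAlgType

end AlgebraicType

/-! ### Absence of cancellation in expansions. -/

section Independence

variable (K : Type u) {L : Type w} {Γ : Type g} [Field K] [Field L] [Algebra K L]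
  [LinearOrderedCommGroupWithZero Γ] (v : Valuation L Γ)

/-- The value of `f` is not torsion modulo `vK`. -/
def IsNontorsion (f : L) : Prop :=
  ∀ (m : ℤ) (c : K), v (f ^ m * algebraMap K L c) = 1 → m = 0

variable {K v}

lemma exists_pow_of_not_isNontorsion {f : L} (h : ¬ IsNontorsion K v f) :
    ∃ e : ℕ, 0 < e ∧ ∃ c : K, v (f ^ e * algebraMap K L c) = 1 := by
  simp only [IsNontorsion, not_forall] at h
  obtain ⟨m, c, h, hm⟩ := h
  refine ⟨m.natAbs, Int.natAbs_pos.2 hm, ?_⟩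
  rcases Int.natAbs_eq m with h' | h'
  · rw [h', zpow_natCast] at h; exact ⟨c, h⟩
  · rw [h', zpow_neg, zpow_natCast] at h
    refine ⟨c⁻¹, ?_⟩
    rw [← inv_inj, ← map_inv₀, mul_inv, ← map_inv₀ (algebraMap K L), inv_inv, h, inv_one]

lemma IsNontorsion.eq_zero_of_isAlgType {f : L} (hf : IsNontorsion K v f) {b : L}
    (hb : IsAlgType K v b) {m : ℤ} (h : v (b * f ^ m) = 1) : m = 0 := by
  obtain ⟨e, he, c, hc, -⟩ := hb
  have hc0 : v (algebraMap K L c) ≠ 0 := by rintro h; rw [map_mul, h, mul_zero] at hc; simp at hc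
  have : v (f ^ (m * e) * algebraMap K L c⁻¹) = 1 := by
    rw [map_mul, map_pow] at hc
    rw [map_mul, map_zpow₀] at h
    rw [map_inv₀, map_mul, map_inv₀, map_zpow₀, zpow_mul, zpow_natCast,
      eq_inv_of_mul_eq_one_right h, inv_pow, eq_inv_of_mul_eq_one_left hc, inv_inv,
      mul_inv_cancel₀ hc0]
  have := hf _ _ this
  exact (mul_eq_zero.1 this).resolve_right (by exact_mod_cast he.ne')

/-- An algebraic residue would make `f ^ e * b`, hence `f ^ e`, hence `f`, of algebraic type. -/
lemma transcendental_res {f : L} (hf : ¬ IsAlgType K v f) {e : ℕ} (he : 0 < e) {b : L}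
    (hb : IsAlgType K v b) (h : v (f ^ e * b) = 1) :
    Transcendental (ResField (restr K v)) (res v (f ^ e * b)) := by
  intro ha
  have h1 := (IsAlgType.of_isAlgebraic h ha).div hb
  rw [mul_div_cancel_right₀ _ hb.ne_zero] at h1
  exact hf (h1.of_pow he)

/-- A root of a polynomial with algebraic coefficients, not all zero, is algebraic. -/
lemma isAlgebraic_of_sum_eq_zero {k : Type u} {Ω : Type w} [Field k] [Field Ω] [Algebra k Ω]
    (s : Finset ℕ) (ρ : ℕ → Ω) (hρ : ∀ i ∈ s, IsAlgebraic k (ρ i)) {z : Ω}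
    (h : ∑ i ∈ s, ρ i * z ^ i = 0) {j : ℕ} (hj : j ∈ s) (hj0 : ρ j ≠ 0) : IsAlgebraic k z := by
  have : ∀ i ∈ s, ∃ c : algebraicClosure k Ω, (c : Ω) = ρ i :=
    fun i hi => ⟨⟨ρ i, mem_algebraicClosure_iff.2 (hρ i hi)⟩, rfl⟩
  choose! c hc using this
  have hz : IsAlgebraic (algebraicClosure k Ω) z := by
    refine ⟨∑ i ∈ s, Polynomial.monomial i (c i), ?_, ?_⟩
    · intro h0
      have := congrArg (fun q => Polynomial.coeff q j) h0
      simp only [Polynomial.finsetSum_coeff, Polynomial.coeff_monomial, Polynomial.coeff_zero] at this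
      rw [Finset.sum_ite_eq' s j, if_pos hj] at this
      exact hj0 (by rw [← hc j hj, this]; rfl)
    · rw [map_sum, ← h]
      refine Finset.sum_congr rfl fun i hi => ?_
      rw [Polynomial.aeval_monomial, ← hc i hi]; rfl
  exact hz.restrictScalars k

/-- Elements which look like distinct `e`-th roots of powers of a transcendental element `t`, up to
algebraic factors, do not add up to zero. -/
lemma sum_ne_zero_of_transcendental {k : Type u} {κ : Type w} [Field k] [Field κ] [Algebra k κ]
    {e : ℕ} (he : 0 < e) {t : κ} (hT : Transcendental k t) (s : Finset ℕ) (ρ : ℕ → κ) {j : ℕ}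
    (hj : j ∈ s) (hj0 : ρ j ≠ 0)
    (hρ : ∀ i ∈ s, IsAlgebraic k (ρ i ^ e * t ^ j * (t ^ i)⁻¹)) : ∑ i ∈ s, ρ i ≠ 0 := by
  intro hsum
  have ht0 : t ≠ 0 := by rintro rfl; exact hT isAlgebraic_zero
  -- With `z ^ e = t`, the elements `ρ i * z ^ j / z ^ i` are algebraic because their `e`-th powers
  -- are. A vanishing sum becomes a polynomial relation for `z` with these coefficients, so `z` and
  -- `t` would be algebraic.
  obtain ⟨z, hz⟩ := IsAlgClosed.exists_pow_nat_eq (algebraMap κ (AlgebraicClosure κ) t) he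
  have hz0 : z ≠ 0 := by
    rintro rfl
    rw [zero_pow he.ne', eq_comm, map_eq_zero] at hz
    exact ht0 hz
  refine hT ((isAlgebraic_algebraMap_iff (algebraMap κ (AlgebraicClosure κ)).injective).1 ?_)
  rw [← hz]
  refine IsAlgebraic.pow (isAlgebraic_of_sum_eq_zero s
    (fun i => algebraMap κ (AlgebraicClosure κ) (ρ i) * z ^ j / z ^ i) ?_ ?_ hj ?_) e
  · intro i hi
    refine IsAlgebraic.of_pow he ?_
    have e2 : (algebraMap κ (AlgebraicClosure κ) (ρ i) * z ^ j / z ^ i) ^ e =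
        algebraMap κ (AlgebraicClosure κ) (ρ i ^ e * t ^ j * (t ^ i)⁻¹) := by
      simp only [map_mul, map_pow, map_inv₀, ← hz, mul_pow, div_pow, ← pow_mul]
      field_simp
      ring
    rw [e2]
    exact (hρ i hi).algebraMap
  · have : ∀ i, algebraMap κ (AlgebraicClosure κ) (ρ i) * z ^ j / z ^ i * z ^ i =
        algebraMap κ (AlgebraicClosure κ) (ρ i) * z ^ j := fun i => by field_simp
    simp only [this]
    rw [← Finset.sum_mul, ← map_sum, hsum]; simp
  · rw [mul_div_cancel_right₀ _ (pow_ne_zero _ hz0)]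
    simpa using hj0

/-- Divide by the maximal term: a drop in value means that the residues of the quotients add up to
zero, while the `j`-th residue is 1. If `f` is nontorsion, only that quotient has value 1. Otherwise
some `f ^ e * c` has transcendental residue and `sum_ne_zero_of_transcendental` applies. -/
lemma le_val_sum_of_forall_le {f : L} (hf0 : f ≠ 0) (hf : ¬ IsAlgType K v f) (s : Finset ℕ)
    {a : ℕ → L} (ha : ∀ i ∈ s, IsAlgType K v (a i) ∨ a i = 0) {j : ℕ} (hj : j ∈ s)
    (hmax : ∀ i ∈ s, v (a i * f ^ i) ≤ v (a j * f ^ j)) :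
    v (a j * f ^ j) ≤ v (∑ i ∈ s, a i * f ^ i) := by
  by_cases haj : a j = 0
  · simp [haj]
  by_contra! hlt
  have hm0 : a j * f ^ j ≠ 0 := mul_ne_zero haj (pow_ne_zero _ hf0)
  have hv0 : 0 < v (a j * f ^ j) := zero_lt_iff.2 ((Valuation.ne_zero_iff v).2 hm0)
  set r : ℕ → L := fun i => a i * f ^ i / (a j * f ^ j) with hr
  have hr1 : ∀ i ∈ s, v (r i) ≤ 1 := fun i hi => by
    simp only [hr]; rw [map_div₀]; exact div_le_one_of_le₀ (hmax i hi) zero_le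
  have hrj : r j = 1 := div_self hm0
  have hsum : ∑ i ∈ s, res v (r i) = 0 := by
    rw [← res_sum s hr1, res_eq_zero_iff (val_sum_le s hr1), ← Finset.sum_div, map_div₀]
    exact (div_lt_one₀ hv0).2 hlt
  have hb : ∀ i ∈ s, a i ≠ 0 → IsAlgType K v (a i / a j) := fun i hi h0 =>
    ((ha i hi).resolve_right h0).div ((ha j hj).resolve_right haj)
  have hri : ∀ i, r i = a i / a j * f ^ ((i : ℤ) - j) := fun i => by
    simp only [hr]; rw [zpow_sub₀ hf0, zpow_natCast, zpow_natCast]; field_simp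
  by_cases ht : IsNontorsion K v f
  · rw [Finset.sum_eq_single_of_mem j hj, hrj, res_one] at hsum
    · exact one_ne_zero hsum
    · intro i hi hij
      rw [res_eq_zero_iff (hr1 i hi)]
      refine (hr1 i hi).lt_of_ne fun h1 => hij ?_
      have hai : a i ≠ 0 := by rintro h0; simp [hr, h0] at h1
      have := ht.eq_zero_of_isAlgType (hb i hi hai) (hri i ▸ h1)
      omega
  · obtain ⟨e, he, c, hc⟩ := exists_pow_of_not_isNontorsion ht
    have hc0 : c ≠ 0 := by rintro rfl; simp at hc
    have hT := transcendental_res hf he (IsAlgType.of_base hc0) hc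
    refine sum_ne_zero_of_transcendental he hT s (fun i => res v (r i)) hj (by simp [hrj]) ?_ hsum
    intro i hi
    rcases (hr1 i hi).lt_or_eq with h1 | h1
    · simp [(res_eq_zero_iff (hr1 i hi)).2 h1, he.ne', isAlgebraic_zero]
    have hai : a i ≠ 0 := by rintro h0; simp [hr, h0] at h1
    have hca : algebraMap K L c ≠ 0 := by simpa using hc0
    set t := f ^ e * algebraMap K L c with htdef
    have ht0 : t ≠ 0 := by rintro h0; simp [h0] at hc
    have e1 : r i ^ e * t ^ j * (t ^ i)⁻¹ =
        (a i / a j) ^ e * algebraMap K L c ^ j / algebraMap K L c ^ i := by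
      simp only [hr, htdef, mul_pow, div_pow, ← pow_mul]; field_simp; ring
    have hti : v (t ^ i)⁻¹ = 1 := by rw [map_inv₀, map_pow, hc]; simp
    have htj : v (t ^ j) = 1 := by rw [map_pow, hc]; simp
    have hre : v (r i ^ e) = 1 := by rw [map_pow, h1]; simp
    have e2 : res v (r i) ^ e * res v t ^ j * (res v t ^ i)⁻¹ =
        res v (r i ^ e * t ^ j * (t ^ i)⁻¹) := by
      rw [res_mul (by simp [hre, htj]) hti.le, res_mul hre.le htj.le,
        res_inv (by rw [map_pow, hc, one_pow]), res_pow hc.le, res_pow hc.le, res_pow h1.le]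
    rw [e2]
    refine IsAlgType.isAlgebraic_res ?_ ?_
    · rw [e1, ← map_pow, ← map_pow]
      exact (((hb i hi hai).pow e).mul (.of_base (pow_ne_zero _ hc0))).div
        (.of_base (pow_ne_zero _ hc0))
    · rw [map_mul, map_mul, hti, hre, htj]; simp

/-- An expansion in powers of an element not of algebraic type, with coefficients of algebraic
type, has the maximum of the values of its terms as its value. -/
lemma le_val_sum {f : L} (hf0 : f ≠ 0) (hf : ¬ IsAlgType K v f) (s : Finset ℕ)
    {a : ℕ → L} (ha : ∀ i ∈ s, IsAlgType K v (a i) ∨ a i = 0) {i : ℕ} (hi : i ∈ s) :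
    v (a i * f ^ i) ≤ v (∑ i ∈ s, a i * f ^ i) := by
  obtain ⟨j, hj, hmax⟩ := s.exists_max_image (fun i => v (a i * f ^ i)) ⟨i, hi⟩
  exact (hmax i hi).trans (le_val_sum_of_forall_le hf0 hf s ha hj hmax)

end Independence

/-! ### Equality of leading terms. -/

section Sim

variable {L : Type w} {Γ : Type g} [Field L] [LinearOrderedCommGroupWithZero Γ]
  (v : Valuation L Γ)

/-- `y` and `a` have the same leading term. -/
def Sim (y a : L) : Prop := v (y - a) < v a

variable {v}

namespace Sim

lemma refl {a : L} (ha : a ≠ 0) : Sim v a a := by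
  simpa [Sim] using zero_lt_iff.2 ((Valuation.ne_zero_iff v).2 ha)

lemma val_eq {y a : L} (h : Sim v y a) : v y = v a := map_eq_of_sub_lt h

lemma right_ne_zero {y a : L} (h : Sim v y a) : a ≠ 0 := by
  rintro rfl; simp [Sim] at h

lemma symm {y a : L} (h : Sim v y a) : Sim v a y := sub_lt_symm h

lemma trans {x y z : L} (h : Sim v x y) (h' : Sim v y z) : Sim v x z := by
  have : x - z = (x - y) + (y - z) := by ring
  rw [Sim, this]
  exact v.map_add_lt (by rw [← h'.val_eq]; exact h) h'

lemma mul {x y a b : L} (h : Sim v x a) (h' : Sim v y b) : Sim v (x * y) (a * b) := by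
  have : x * y - a * b = (x - a) * y + a * (y - b) := by ring
  have ha := zero_lt_iff.2 ((Valuation.ne_zero_iff v).2 h.right_ne_zero)
  have hb := zero_lt_iff.2 ((Valuation.ne_zero_iff v).2 h'.right_ne_zero)
  rw [Sim, this]
  refine v.map_add_lt ?_ ?_
  · rw [map_mul, map_mul, h'.val_eq]; exact mul_lt_mul_of_pos_right h hb
  · rw [map_mul, map_mul]; exact mul_lt_mul_of_pos_left h' ha

lemma res_eq {x y : L} (h : Sim v x y) (hy : v y ≤ 1) : res v x = res v y := by
  rw [res_eq_iff (h.val_eq.trans_le hy) hy]; exact lt_of_lt_of_le h hy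

lemma of_res_eq {x y : L} (hx : v x ≤ 1) (hy : v y = 1) (h : res v x = res v y) : Sim v x y := by
  rw [res_eq_iff hx hy.le] at h; rwa [Sim, hy]

end Sim

end Sim

/-! ### Linear independence from values and residues. -/

section LinearIndependence

variable {K : Type u} {L : Type w} {Γ : Type g} [Field K] [Field L] [Algebra K L]
  [LinearOrderedCommGroupWithZero Γ] {v : Valuation L Γ}

/-- Dividing a relation by its largest coefficient gives integral coefficients, one of them 1, so it
reduces to a nontrivial relation between residues. -/
lemma linearIndependent_of_res {ι : Type*} {y : ι → L} (hy : ∀ i, v (y i) ≤ 1)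
    (h : LinearIndependent (ResField (restr K v)) (fun i => res v (y i))) :
    LinearIndependent K y := by
  rw [linearIndependent_iff']
  intro s c hc
  by_contra! hne
  obtain ⟨j₀, hj₀, hcj₀⟩ := hne
  obtain ⟨j, hj, hmax⟩ := s.exists_max_image (fun i => v (algebraMap K L (c i))) ⟨j₀, hj₀⟩
  have hpos : 0 < v (algebraMap K L (c j)) :=
    lt_of_lt_of_le (zero_lt_iff.2 ((Valuation.ne_zero_iff v).2 (by simpa using hcj₀))) (hmax _ hj₀)
  have hcj : c j ≠ 0 := by rintro h0; simp [h0] at hpos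
  have hle : ∀ i ∈ s, v (algebraMap K L (c i / c j)) ≤ 1 := fun i hi => by
    rw [map_div₀, map_div₀]; exact div_le_one_of_le₀ (hmax i hi) zero_le
  have hle' : ∀ i ∈ s, v (algebraMap K L (c i / c j) * y i) ≤ 1 := fun i hi => by
    rw [map_mul]; exact mul_le_one' (hle i hi) (hy i)
  have hsum : ∑ i ∈ s, algebraMap K L (c i / c j) * y i = 0 := by
    have : ∀ i, algebraMap K L (c i / c j) * y i = (algebraMap K L (c j))⁻¹ * (c i • y i) :=
      fun i => by rw [Algebra.smul_def, map_div₀]; ring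
    simp only [this]
    rw [← Finset.mul_sum, hc, mul_zero]
  have h0 := res_sum s hle'
  rw [hsum, res_zero] at h0
  have := linearIndependent_iff'.1 h s (fun i => res (restr K v) (c i / c j)) ?_ j hj
  · rw [div_self hcj, res_one] at this; exact one_ne_zero this
  · rw [h0]
    refine Finset.sum_congr rfl fun i hi => ?_
    rw [Algebra.smul_def, algebraMap_res (hle i hi), ← res_mul (hle i hi) (hy i)]

/-- The nonzero terms of a relation have distinct values, so the largest cannot cancel. -/
lemma linearIndependent_of_val {ι : Type*} {y : ι → L} (hy : ∀ i, y i ≠ 0)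
    (h : ∀ i j (c : K), v (y i) = v (algebraMap K L c * y j) → i = j) :
    LinearIndependent K y := by
  classical
  rw [linearIndependent_iff']
  intro s c hc
  by_contra! hne
  obtain ⟨j₀, hj₀, hcj₀⟩ := hne
  obtain ⟨j, hj, hmax⟩ := s.exists_max_image (fun i => v (c i • y i)) ⟨j₀, hj₀⟩
  have hpos : 0 < v (c j • y j) :=
    lt_of_lt_of_le (zero_lt_iff.2 ((Valuation.ne_zero_iff v).2 (smul_ne_zero hcj₀ (hy _))))
      (hmax _ hj₀)
  have hcj : c j ≠ 0 := by rintro h0; simp [h0] at hpos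
  rw [← Finset.add_sum_erase _ _ hj] at hc
  have hlt : v (∑ i ∈ s.erase j, c i • y i) < v (c j • y j) := by
    refine v.map_sum_lt hpos.ne' fun i hi => ?_
    refine (hmax i (Finset.mem_of_mem_erase hi)).lt_of_ne fun he => Finset.ne_of_mem_erase hi ?_
    symm
    refine h j i ((c j)⁻¹ * c i) ?_
    have hcj' : v (algebraMap K L (c j)) ≠ 0 := by simpa using hcj
    rw [Algebra.smul_def, Algebra.smul_def, map_mul, map_mul v] at he
    rw [map_mul, map_mul, map_mul, map_inv₀, map_inv₀, mul_assoc, he, inv_mul_cancel_left₀ hcj']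
  rw [eq_neg_of_add_eq_zero_left hc, Valuation.map_neg] at hlt
  exact lt_irrefl _ hlt

lemma rank_le_of_forall_exists_res (V : Submodule K L) (W : Submodule (ResField (restr K v)) (ResField v))
    (h : ∀ z ∈ W, ∃ y ∈ V, v y ≤ 1 ∧ res v y = z) :
    Module.rank (ResField (restr K v)) W ≤ Module.rank K V := by
  let b := Module.Basis.ofVectorSpace (ResField (restr K v)) W
  choose y hyV hy hyb using fun i => h (b i) (b i).2
  rw [← b.mk_eq_rank'']
  have hli : LinearIndependent K y := by
    refine linearIndependent_of_res (v := v) hy ?_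
    simp only [hyb]
    exact b.linearIndependent.map' W.subtype (Submodule.ker_subtype _)
  have : LinearIndependent K (fun i => (⟨y i, hyV i⟩ : V)) :=
    LinearIndependent.of_comp V.subtype hli
  exact this.cardinal_le_rank

-- `R` picks one element for each coset of `vK` met by the values of `V`; such elements are linearly
-- independent by `linearIndependent_of_val`, which bounds their number by the dimension.
variable (v) in
lemma exists_set_val_representatives (V : Submodule K L) :
    ∃ R : Set L, R ⊆ V ∧ (0 : L) ∉ R ∧ Cardinal.mk R ≤ Module.rank K V ∧
      ∀ y ∈ V, y ≠ 0 → ∃ r ∈ R, ∃ c : K, v y = v (algebraMap K L c * r) := by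
  let S := {y : L // y ∈ V ∧ y ≠ 0}
  let st : Setoid S :=
    { r := fun y z => ∃ c : K, v y = v (algebraMap K L c * z)
      iseqv :=
        { refl := fun y => ⟨1, by simp⟩
          symm := by
            rintro ⟨y, hy, hy0⟩ ⟨z, hz, hz0⟩ ⟨c, hc⟩
            dsimp only at hc ⊢
            have hc0 : v (algebraMap K L c) ≠ 0 := by
              rintro h0
              rw [map_mul, h0, zero_mul, Valuation.zero_iff] at hc; exact hy0 hc
            exact ⟨c⁻¹, by rw [map_mul, map_inv₀, map_inv₀, hc, map_mul, inv_mul_cancel_left₀ hc0]⟩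
          trans := by
            rintro x y z ⟨c, hc⟩ ⟨d, hd⟩
            exact ⟨c * d, by rw [hc, map_mul, hd, map_mul, map_mul, map_mul, map_mul, mul_assoc]⟩ } }
  let rep : Quotient st → L := fun q => (Quotient.out q).1
  have hinj : ∀ i j (c : K), v (rep i) = v (algebraMap K L c * rep j) → i = j := by
    intro i j c hc
    rw [← Quotient.out_eq i, ← Quotient.out_eq j]
    exact Quotient.sound ⟨c, hc⟩
  have hrep : Function.Injective rep := fun i j h => hinj i j 1 (by simp [h])
  refine ⟨Set.range rep, ?_, ?_, ?_, ?_⟩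
  · rintro _ ⟨q, rfl⟩; exact (Quotient.out q).2.1
  · rintro ⟨q, h⟩; exact (Quotient.out q).2.2 h
  · rw [Cardinal.mk_range_eq _ hrep]
    have hli := linearIndependent_of_val (K := K) (v := v) (fun q => (Quotient.out q).2.2) hinj
    have : LinearIndependent K (fun q => (⟨rep q, (Quotient.out q).2.1⟩ : V)) :=
      LinearIndependent.of_comp V.subtype hli
    exact this.cardinal_le_rank
  · intro y hy hy0
    refine ⟨_, ⟨Quotient.mk st ⟨y, hy, hy0⟩, rfl⟩, ?_⟩
    obtain ⟨c, hc⟩ := st.symm (Quotient.mk_out (s := st) ⟨y, hy, hy0⟩)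
    exact ⟨c, hc⟩

end LinearIndependence

lemma finiteDimensional_of_rank_lt_aleph0 {k : Type u} {κ : Type w} [Field k] [Field κ]
    [Algebra k κ] (E : IntermediateField k κ)
    (h : Module.rank k (Subalgebra.toSubmodule E.toSubalgebra) < Cardinal.aleph0) :
    FiniteDimensional k E := Module.rank_lt_aleph0_iff.1 h

/-! ### Digit spaces and the residue field of the digits. -/

section DigitSpace

variable (K : Type u) {L : Type w} {Γ : Type g} [Field K] [Field L] [Algebra K L]
  [LinearOrderedCommGroupWithZero Γ] (v : Valuation L Γ)

/-- `D` is a space of digits for expansions in powers of `f`, where `f` is not of algebraic type,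
but the digits are. -/
structure IsDigitSpace (f : L) (D : Submodule K L) : Prop where
  not_isAlgType : ¬ IsAlgType K v f
  ne_zero : f ≠ 0
  finite : Module.Finite K D
  isAlgType : ∀ a ∈ D, a ≠ 0 → IsAlgType K v a
  one_mem : (1 : L) ∈ D
  mul_eq : ∀ a ∈ D, ∀ b ∈ D, ∃ q ∈ D, ∃ r ∈ D, a * b = q * f + r
  exists_eq_div : ∀ y : L, ∃ (s s' : Finset ℕ) (a a' : ℕ → L),
    (∀ i ∈ s, a i ∈ D) ∧ (∀ i ∈ s', a' i ∈ D) ∧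
      ∑ i ∈ s', a' i * f ^ i ≠ 0 ∧ y = (∑ i ∈ s, a i * f ^ i) / ∑ i ∈ s', a' i * f ^ i

variable {K v}

namespace IsDigitSpace

variable {f : L} {D : Submodule K L} (hD : IsDigitSpace K v f D)

include hD

lemma isAlgType_or {a : L} (ha : a ∈ D) : IsAlgType K v a ∨ a = 0 := by
  by_cases h : a = 0
  · exact .inr h
  · exact .inl (hD.isAlgType a ha h)

/-- If `q * f` were at least as large as `a * b`, then `q * f = a * b - r` would be of algebraic
type, being either dominated by `-r` or a sum without drop in value. Then `f` would be too. So
modulo `f` the leading term of a product of digits is not lost. -/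
lemma sim_of_mul_eq {a b q r : L} (ha : a ∈ D) (hb : b ∈ D) (hq : q ∈ D) (hr : r ∈ D)
    (ha0 : a ≠ 0) (hb0 : b ≠ 0) (h : a * b = q * f + r) : Sim v (a * b) r := by
  have hab := (hD.isAlgType a ha ha0).mul (hD.isAlgType b hb hb0)
  have key : v (q * f) < v (a * b) := by
    by_contra! hle
    have hqf0 : q * f ≠ 0 := by
      rintro h0
      rw [h0, map_zero, le_zero_iff, Valuation.zero_iff] at hle
      exact hab.ne_zero hle
    have hq0 : q ≠ 0 := left_ne_zero_of_mul hqf0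
    have hqf : IsAlgType K v (a * b + -r) ∨ False := by
      by_cases h1 : v (a * b) < v (q * f)
      · left
        have hvr : v r = v (q * f) := by
          have : r = a * b - q * f := by rw [h]; ring
          rw [this]; exact v.map_sub_eq_of_lt_right h1
        have hr0 : r ≠ 0 := by
          rintro rfl; rw [map_zero] at hvr; exact hqf0 ((Valuation.zero_iff v).1 hvr.symm)
        have := (hD.isAlgType _ (D.neg_mem hr) (neg_ne_zero.2 hr0))
        refine this.of_sub_lt ?_
        rw [Valuation.map_neg, hvr]
        simpa using h1
      · left
        push Not at h1
        have e : a * b + -r = q * f := by rw [h]; ring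
        have hv : v (q * f) = v (a * b) := le_antisymm h1 hle
        refine IsAlgType.add (.inl hab) (hD.isAlgType_or (D.neg_mem hr)) (e ▸ hqf0) ?_ ?_
        · rw [e, hv]
        · rw [e, hv, Valuation.map_neg]
          have : r = a * b - q * f := by rw [h]; ring
          rw [this]
          exact v.map_sub_le le_rfl hv.le
    have hqf := hqf.resolve_right id
    have e : a * b + -r = q * f := by rw [h]; ring
    rw [e] at hqf
    have := hqf.div (hD.isAlgType q hq hq0)
    rw [mul_div_cancel_left₀ _ hq0] at this
    exact hD.not_isAlgType this
  refine Sim.symm ?_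
  have : r - a * b = -(q * f) := by rw [h]; ring
  rw [Sim, this, Valuation.map_neg]; exact key

lemma exists_sim_mul {a b : L} (ha : a ∈ D) (hb : b ∈ D) (ha0 : a ≠ 0) (hb0 : b ≠ 0) :
    ∃ r ∈ D, Sim v (a * b) r := by
  obtain ⟨q, hq, r, hr, h⟩ := hD.mul_eq a ha b hb
  exact ⟨r, hr, hD.sim_of_mul_eq ha hb hq hr ha0 hb0 h⟩

/-- The subalgebra of residues of digits. -/
def digitAlgebra : Subalgebra (ResField (restr K v)) (ResField v) where
  carrier := {z | ∃ a ∈ D, v a ≤ 1 ∧ res v a = z}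
  mul_mem' := by
    rintro _ _ ⟨a, ha, hva, rfl⟩ ⟨b, hb, hvb, rfl⟩
    by_cases ha0 : a = 0
    · exact ⟨0, D.zero_mem, by simp, by simp [ha0]⟩
    by_cases hb0 : b = 0
    · exact ⟨0, D.zero_mem, by simp, by simp [hb0]⟩
    -- The product of two digits need not be a digit, but its remainder is one with the same leading
    -- term.
    obtain ⟨r, hr, hs⟩ := hD.exists_sim_mul ha hb ha0 hb0
    have hab : v (a * b) ≤ 1 := by rw [map_mul]; exact mul_le_one' hva hvb
    have hvr : v r ≤ 1 := hs.val_eq ▸ hab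
    exact ⟨r, hr, hvr, by rw [← hs.res_eq hvr, res_mul hva hvb]⟩
  add_mem' := by
    rintro _ _ ⟨a, ha, hva, rfl⟩ ⟨b, hb, hvb, rfl⟩
    exact ⟨a + b, D.add_mem ha hb, v.map_add_le hva hvb, res_add hva hvb⟩
  algebraMap_mem' := by
    intro z
    obtain ⟨c, hc, h⟩ := exists_algebraMap_res_eq z
    refine ⟨algebraMap K L c, ?_, hc, h⟩
    rw [Algebra.algebraMap_eq_smul_one]; exact D.smul_mem _ hD.one_mem

/-- The field of residues of digits. -/
def digitField : IntermediateField (ResField (restr K v)) (ResField v) :=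
  { hD.digitAlgebra with
    inv_mem' := by
      intro z hz
      have : IsAlgebraic (ResField (restr K v)) z := by
        obtain ⟨a, ha, hva, rfl⟩ := hz
        rcases hD.isAlgType_or ha with h | rfl
        · exact h.isAlgebraic_res hva
        · simp [isAlgebraic_zero]
      exact Subalgebra.inv_mem_of_algebraic hD.digitAlgebra (x := ⟨z, hz⟩) this }

lemma finiteDimensional_digitField :
    FiniteDimensional (ResField (restr K v)) hD.digitField := by
  have := hD.finite
  refine finiteDimensional_of_rank_lt_aleph0 _ (lt_of_le_of_lt (rank_le_of_forall_exists_res D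
    (Subalgebra.toSubmodule hD.digitField.toSubalgebra) fun z hz => hz) (Module.rank_lt_aleph0 K D))

lemma sim_mul {x y : L} (hx : ∃ a ∈ D, Sim v x a) (hy : ∃ a ∈ D, Sim v y a) :
    ∃ a ∈ D, Sim v (x * y) a := by
  obtain ⟨a, ha, h⟩ := hx
  obtain ⟨b, hb, h'⟩ := hy
  obtain ⟨r, hr, hs⟩ := hD.exists_sim_mul ha hb h.right_ne_zero h'.right_ne_zero
  exact ⟨r, hr, (h.mul h').trans hs⟩

lemma sim_pow {x : L} (hx : ∃ a ∈ D, Sim v x a) (n : ℕ) : ∃ a ∈ D, Sim v (x ^ n) a := by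
  induction n with
  | zero => exact ⟨1, hD.one_mem, by rw [pow_zero]; exact .refl one_ne_zero⟩
  | succ n ih => rw [pow_succ]; exact hD.sim_mul ih hx

lemma isAlgType_of_sim {x : L} (hx : ∃ a ∈ D, Sim v x a) : IsAlgType K v x := by
  obtain ⟨a, ha, h⟩ := hx
  exact (hD.isAlgType a ha h.right_ne_zero).of_sub_lt h

lemma res_mem_digitField {x : L} (hx : ∃ a ∈ D, Sim v x a) (h : v x ≤ 1) :
    res v x ∈ hD.digitField := by
  obtain ⟨a, ha, hs⟩ := hx
  have : v a ≤ 1 := hs.val_eq ▸ h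
  exact ⟨a, ha, this, (hs.res_eq this).symm⟩

lemma sim_base {c : K} (hc : c ≠ 0) : ∃ a ∈ D, Sim v (algebraMap K L c) a :=
  ⟨_, by rw [Algebra.algebraMap_eq_smul_one]; exact D.smul_mem _ hD.one_mem, .refl (by simpa)⟩

lemma sim_of_res_mem {x : L} (h : v x = 1) (hx : res v x ∈ hD.digitField) :
    ∃ a ∈ D, Sim v x a := by
  obtain ⟨a, ha, hva, hr⟩ := hx
  refine ⟨a, ha, .of_res_eq h.le ?_ hr.symm⟩
  refine hva.lt_or_eq.resolve_left fun hlt => res_ne_zero h ?_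
  rw [← hr, res_eq_zero_iff hva]; exact hlt

/-- Some `x ^ (e + 1) * c` has value 1 and residue in the digit field, where inverses exist.
Multiplying the inverse by `x ^ e * c` recovers `x⁻¹`. -/
lemma sim_inv {x : L} (hx : ∃ a ∈ D, Sim v x a) : ∃ a ∈ D, Sim v x⁻¹ a := by
  obtain ⟨e, he, c, hc, -⟩ := hD.isAlgType_of_sim hx
  obtain ⟨e, rfl⟩ := Nat.exists_eq_succ_of_ne_zero he.ne'
  have hc0 : c ≠ 0 := by rintro rfl; simp at hc
  have h1 : ∃ a ∈ D, Sim v (x ^ e * algebraMap K L c) a :=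
    hD.sim_mul (hD.sim_pow hx e) (hD.sim_base hc0)
  have h2 : ∃ a ∈ D, Sim v (x ^ e.succ * algebraMap K L c) a :=
    hD.sim_mul (hD.sim_pow hx _) (hD.sim_base hc0)
  have h3 : ∃ a ∈ D, Sim v (x ^ e.succ * algebraMap K L c)⁻¹ a := by
    refine hD.sim_of_res_mem (by rw [map_inv₀, hc, inv_one]) ?_
    rw [res_inv hc]
    exact inv_mem (hD.res_mem_digitField h2 hc.le)
  have h4 := hD.sim_mul h1 h3
  have hx0 := (hD.isAlgType_of_sim hx).ne_zero
  have hc0' : algebraMap K L c ≠ 0 := by simpa using hc0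
  have : x ^ e * algebraMap K L c * (x ^ e.succ * algebraMap K L c)⁻¹ = x⁻¹ := by
    rw [Nat.succ_eq_add_one, pow_succ]; field_simp
  rwa [this] at h4

lemma sim_div {x y : L} (hx : ∃ a ∈ D, Sim v x a) (hy : ∃ a ∈ D, Sim v y a) :
    ∃ a ∈ D, Sim v (x / y) a := by
  rw [div_eq_mul_inv]; exact hD.sim_mul hx (hD.sim_inv hy)

lemma sim_zpow {x : L} (hx : ∃ a ∈ D, Sim v x a) (m : ℤ) : ∃ a ∈ D, Sim v (x ^ m) a := by
  cases m with
  | ofNat m => simpa using hD.sim_pow hx m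
  | negSucc m => rw [zpow_negSucc]; exact hD.sim_inv (hD.sim_pow hx _)

end IsDigitSpace

end DigitSpace

/-! ### Rational rank and generation of quotient groups. -/

section Groups

variable {G : Type g} [CommGroup G]

/-- Tensoring with `ℚ` is localization at the nonzero integers, which preserves rank. -/
lemma rationalRank_eq_rank_int (A : Type g) [CommGroup A] :
    rationalRank A = Module.rank ℤ (Additive A) := by
  have h1 : Module.rank ℚ (ℚ ⊗[ℤ] Additive A) = Module.rank ℤ (ℚ ⊗[ℤ] Additive A) :=
    IsLocalization.rank_eq ℚ (nonZeroDivisors ℤ) le_rfl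
  rw [rationalRank, h1]
  have := IsLocalization.tensorProduct_isLocalizedModule (nonZeroDivisors ℤ) ℚ
    (M := Additive A)
  have h2 := @IsLocalizedModule.rank_eq _ _ _ _ _ (nonZeroDivisors ℤ) le_rfl _ _ _
    (TensorProduct.mk ℤ ℚ (Additive A) 1) this
  exact h2

lemma rationalRank_eq_zero_iff (A : Type g) [CommGroup A] :
    rationalRank A = 0 ↔ ∀ x : A, ∃ n : ℕ, 0 < n ∧ x ^ n = 1 := by
  rw [rationalRank_eq_rank_int, rank_eq_zero_iff]
  constructor
  · intro h x
    obtain ⟨m, hm, hx⟩ := h (Additive.ofMul x)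
    refine ⟨m.natAbs, Int.natAbs_pos.2 hm, ?_⟩
    have : x ^ m = 1 := hx
    rcases Int.natAbs_eq m with h' | h'
    · rwa [h', zpow_natCast] at this
    · rwa [h', zpow_neg, zpow_natCast, inv_eq_one] at this
  · intro h x
    obtain ⟨n, hn, hx⟩ := h x.toMul
    refine ⟨n, by exact_mod_cast hn.ne', ?_⟩
    rw [natCast_zsmul]; exact hx

lemma rationalRank_eq_one {A : Type g} [CommGroup A] (γ : A)
    (hγ : ∀ m : ℤ, γ ^ m = 1 → m = 0)
    (h : ∀ x : A, ∃ n : ℕ, 0 < n ∧ ∃ m : ℤ, x ^ n = γ ^ m) : rationalRank A = 1 := by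
  rw [rationalRank_eq_rank_int]
  let N : Submodule ℤ (Additive A) := Submodule.span ℤ {Additive.ofMul γ}
  have hN : Module.rank ℤ N = 1 := by
    have : LinearIndepOn ℤ id {Additive.ofMul γ} := by
      exact LinearIndepOn.singleton' fun m hm => hγ m hm
    rw [rank_span_set this, Cardinal.mk_singleton]
  have hQ : Module.rank ℤ (Additive A ⧸ N) = 0 := by
    rw [rank_eq_zero_iff]
    intro x
    obtain ⟨x, rfl⟩ := N.mkQ_surjective x
    obtain ⟨n, hn, m, hx⟩ := h x.toMul
    refine ⟨n, by exact_mod_cast hn.ne', ?_⟩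
    rw [← map_zsmul, ← LinearMap.mem_ker, Submodule.ker_mkQ, Submodule.mem_span_singleton]
    refine ⟨m, ?_⟩
    rw [natCast_zsmul]; exact hx.symm
  rw [← rank_quotient_add_rank_of_isDomain N, hN, hQ, zero_add]

/-- Rank-nullity for the exact sequence `H₂/H₁ → H₃/H₁ → H₃/H₂`. -/
lemma rationalRank_add {H₁ H₂ H₃ : Subgroup G} (h₁₂ : H₁ ≤ H₂) (h₂₃ : H₂ ≤ H₃) :
    rationalRank (H₃ ⧸ H₁.subgroupOf H₃) =
      rationalRank (H₃ ⧸ H₂.subgroupOf H₃) + rationalRank (H₂ ⧸ H₁.subgroupOf H₂) := by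
  simp only [rationalRank_eq_rank_int]
  let φ : H₂ ⧸ H₁.subgroupOf H₂ →* H₃ ⧸ H₁.subgroupOf H₃ :=
    QuotientGroup.map _ _ (Subgroup.inclusion h₂₃) fun x hx => hx
  let ψ : H₃ ⧸ H₁.subgroupOf H₃ →* H₃ ⧸ H₂.subgroupOf H₃ :=
    QuotientGroup.map _ _ (MonoidHom.id _) fun x hx => h₁₂ hx
  have hφ : Function.Injective φ := by
    rw [injective_iff_map_eq_one]
    intro x
    refine QuotientGroup.induction_on x fun y hy => ?_
    have hy' : ((Subgroup.inclusion h₂₃ y : H₃) : H₃ ⧸ H₁.subgroupOf H₃) = 1 := hy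
    rw [QuotientGroup.eq_one_iff] at hy' ⊢
    exact hy'
  have hψ : Function.Surjective ψ := fun x =>
    QuotientGroup.induction_on x fun y => ⟨(y : H₃ ⧸ H₁.subgroupOf H₃), rfl⟩
  have hex : ∀ x, ψ x = 1 ↔ ∃ y, φ y = x := by
    intro x
    refine QuotientGroup.induction_on x fun y => ⟨fun hy => ?_, ?_⟩
    · have hy' : (y : H₃ ⧸ H₂.subgroupOf H₃) = 1 := hy
      rw [QuotientGroup.eq_one_iff] at hy'
      exact ⟨((⟨y, hy'⟩ : H₂) : H₂ ⧸ H₁.subgroupOf H₂), rfl⟩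
    · rintro ⟨z, hz⟩
      rw [← hz]
      refine QuotientGroup.induction_on z fun z => ?_
      change ((Subgroup.inclusion h₂₃ z : H₃) : H₃ ⧸ H₂.subgroupOf H₃) = 1
      rw [QuotientGroup.eq_one_iff]
      exact z.2
  let φ' := (MonoidHom.toAdditive φ).toIntLinearMap
  let ψ' := (MonoidHom.toAdditive ψ).toIntLinearMap
  have hker : LinearMap.ker ψ' = LinearMap.range φ' := by
    ext x
    exact hex x.toMul
  have h3 := LinearMap.rank_range_add_rank_ker ψ'
  rw [LinearMap.range_eq_top.2 (show Function.Surjective ψ' from hψ), rank_top, hker,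
    ← (LinearEquiv.ofInjective φ' (show Function.Injective φ' from hφ)).rank_eq] at h3
  exact h3.symm

lemma closure_image_mk_eq_top {H₁ H₂ : Subgroup G} {S : Set G} (hS : S ⊆ H₂)
    (h : H₂ ≤ H₁ ⊔ Subgroup.closure S) :
    Subgroup.closure ((fun x : H₂ => (x : H₂ ⧸ H₁.subgroupOf H₂)) '' (Subtype.val ⁻¹' S)) = ⊤ := by
  rw [eq_top_iff]
  rintro x -
  refine QuotientGroup.induction_on x fun y => ?_
  obtain ⟨a, ha, b, hb, hab⟩ := Subgroup.mem_sup.1 (h y.2)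
  have hmap : Subgroup.closure S = (Subgroup.closure (Subtype.val ⁻¹' S : Set H₂)).map H₂.subtype := by
    rw [MonoidHom.map_closure]
    congr 1
    ext z
    constructor
    · intro hz; exact ⟨⟨z, hS hz⟩, hz, rfl⟩
    · rintro ⟨w, hw, rfl⟩; exact hw
  rw [hmap] at hb
  obtain ⟨b, hb, rfl⟩ := hb
  have hyb : (y : H₂ ⧸ H₁.subgroupOf H₂) = (b : H₂ ⧸ H₁.subgroupOf H₂) := by
    rw [eq_comm, QuotientGroup.eq, Subgroup.mem_subgroupOf]
    have : ((b⁻¹ * y : H₂) : G) = a := by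
      rw [Subgroup.coe_mul, ← hab, Subgroup.coe_inv, mul_comm a, Subgroup.coe_subtype,
        inv_mul_cancel_left]
    rwa [this]
  rw [hyb]
  have := Subgroup.mem_map_of_mem (QuotientGroup.mk' (H₁.subgroupOf H₂)) hb
  rwa [MonoidHom.map_closure] at this

lemma group_fg_quotient {H₁ H₂ : Subgroup G} {S : Set G} (hS : S ⊆ H₂)
    (hfin : S.Finite) (h : H₂ ≤ H₁ ⊔ Subgroup.closure S) : Group.FG (H₂ ⧸ H₁.subgroupOf H₂) := by
  rw [Group.fg_iff]
  exact ⟨_, closure_image_mk_eq_top hS h, (hfin.preimage Subtype.val_injective.injOn).image _⟩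

lemma countable_quotient {H₁ H₂ : Subgroup G} {S : Set G} (hS : S ⊆ H₂)
    (hc : S.Countable) (h : H₂ ≤ H₁ ⊔ Subgroup.closure S) :
    Countable (H₂ ⧸ H₁.subgroupOf H₂) := by
  have := closure_image_mk_eq_top hS h
  have hc' := ((hc.preimage Subtype.val_injective).image
    (fun x : H₂ => (x : H₂ ⧸ H₁.subgroupOf H₂)))
  have : Countable (⊤ : Subgroup (H₂ ⧸ H₁.subgroupOf H₂)) := by
    rw [← this]
    have := hc'.to_subtype
    rw [FreeGroup.closure_eq_range]
    have := (Quot.mk_surjective (r := FreeGroup.Red.Step (α :=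
      ((fun x : H₂ => (x : H₂ ⧸ H₁.subgroupOf H₂)) '' (Subtype.val ⁻¹' S))))).countable
    exact (FreeGroup.lift (Subtype.val : _ → H₂ ⧸ H₁.subgroupOf H₂)).rangeRestrict_surjective.countable
  exact (Equiv.countable_iff Subgroup.topEquiv.toEquiv).1 this

end Groups

/-! ### Value groups in terms of elements. -/

section ValueGroups

variable {L : Type w} {Γ : Type g} [Field L] [LinearOrderedCommGroupWithZero Γ]
  (v : Valuation L Γ)

lemma mem_valGroup_iff {γ : Γˣ} : γ ∈ valGroup v ↔ ∃ y : L, v y = γ := by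
  constructor
  · intro h
    have : (γ : Γ) ∈ Units.val '' (valGroup v : Set Γˣ) := ⟨γ, h, rfl⟩
    rw [MonoidWithZeroHom.valueGroup_eq_range] at this
    obtain ⟨⟨y, hy⟩, -⟩ := this
    exact ⟨y, hy⟩
  · rintro ⟨y, hy⟩
    exact MonoidWithZeroHom.mem_valueGroup _ ⟨y, hy⟩

/-- The value of a nonzero element, as a unit. -/
noncomputable def unitVal (y : L) (hy : y ≠ 0) : Γˣ := Units.mk0 (v y) ((Valuation.ne_zero_iff v).2 hy)

lemma unitVal_mem (y : L) (hy : y ≠ 0) : unitVal v y hy ∈ valGroup v :=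
  (mem_valGroup_iff v).2 ⟨y, rfl⟩

variable (K : Type u) [Field K] [Algebra K L]

lemma valGroup_restr_le : valGroup (restr K v) ≤ valGroup v := by
  intro γ hγ
  obtain ⟨c, hc⟩ := (mem_valGroup_iff _).1 hγ
  exact (mem_valGroup_iff _).2 ⟨_, hc⟩

variable {v}

lemma rationalRank_valQuot_eq_zero_iff : rationalRank (ValQuot K v) = 0 ↔
    ∀ y : L, y ≠ 0 → ∃ e : ℕ, 0 < e ∧ ∃ c : K, v (y ^ e * algebraMap K L c) = 1 := by
  rw [rationalRank_eq_zero_iff]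
  constructor
  · intro h y hy
    obtain ⟨e, he, h1⟩ := h ((⟨unitVal v y hy, unitVal_mem v y hy⟩ : valGroup v) : ValQuot K v)
    rw [← QuotientGroup.mk_pow, QuotientGroup.eq_one_iff, Subgroup.mem_subgroupOf,
      mem_valGroup_iff] at h1
    obtain ⟨c, hc⟩ := h1
    refine ⟨e, he, c⁻¹, ?_⟩
    have hc' : v (algebraMap K L c) = v y ^ e := hc
    rw [map_mul, map_pow, map_inv₀, map_inv₀, hc', mul_inv_cancel₀]
    exact pow_ne_zero _ ((Valuation.ne_zero_iff v).2 hy)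
  · intro h x
    refine QuotientGroup.induction_on x fun γ => ?_
    obtain ⟨y, hy⟩ := (mem_valGroup_iff v).1 γ.2
    have hy0 : y ≠ 0 := by
      rintro rfl; rw [map_zero] at hy; exact γ.1.ne_zero hy.symm
    obtain ⟨e, he, c, hc⟩ := h y hy0
    refine ⟨e, he, ?_⟩
    rw [← QuotientGroup.mk_pow, QuotientGroup.eq_one_iff, Subgroup.mem_subgroupOf,
      mem_valGroup_iff]
    refine ⟨c⁻¹, ?_⟩
    change v (algebraMap K L c⁻¹) = (γ.1 : Γ) ^ e
    rw [map_mul, map_pow] at hc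
    rw [map_inv₀, map_inv₀, ← hy, eq_inv_of_mul_eq_one_left hc]

lemma rationalRank_valQuot_eq_one {f : L} (hf0 : f ≠ 0) (hf : IsNontorsion K v f)
    (h : ∀ y : L, y ≠ 0 → ∃ a m, IsAlgType K v a ∧ v y = v (a * f ^ (m : ℤ))) :
    rationalRank (ValQuot K v) = 1 := by
  refine rationalRank_eq_one
    ((⟨unitVal v f hf0, unitVal_mem v f hf0⟩ : valGroup v) : ValQuot K v) ?_ ?_
  · intro m hm
    rw [← QuotientGroup.mk_zpow, QuotientGroup.eq_one_iff, Subgroup.mem_subgroupOf,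
      mem_valGroup_iff] at hm
    obtain ⟨c, hc⟩ := hm
    have hc' : v (algebraMap K L c) = v f ^ m := by
      refine Eq.trans hc ?_
      simp [unitVal]
    refine hf m c⁻¹ ?_
    rw [map_mul, map_zpow₀, map_inv₀, map_inv₀, hc', mul_inv_cancel₀]
    exact zpow_ne_zero _ ((Valuation.ne_zero_iff v).2 hf0)
  · intro x
    refine QuotientGroup.induction_on x fun γ => ?_
    obtain ⟨y, hy⟩ := (mem_valGroup_iff v).1 γ.2
    have hy0 : y ≠ 0 := by
      rintro rfl; rw [map_zero] at hy; exact γ.1.ne_zero hy.symm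
    obtain ⟨a, m, ⟨e, he, c, hc, -⟩, ham⟩ := h y hy0
    refine ⟨e, he, m * e, ?_⟩
    rw [← QuotientGroup.mk_pow, ← QuotientGroup.mk_zpow, eq_comm, QuotientGroup.eq,
      Subgroup.mem_subgroupOf, mem_valGroup_iff]
    refine ⟨c⁻¹, ?_⟩
    change v (algebraMap K L c⁻¹) = _
    simp only [Subgroup.coe_mul, Subgroup.coe_inv, Subgroup.coe_zpow, Subgroup.coe_pow,
      Units.val_mul, Units.val_pow_eq_pow_val, Units.val_inv_eq_inv_val, Units.val_zpow_eq_zpow_val]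
    have hf1 : v f ^ (m * e) ≠ 0 := zpow_ne_zero _ ((Valuation.ne_zero_iff v).2 hf0)
    rw [← hy, ham, map_mul, map_zpow₀, mul_pow, ← zpow_natCast (v f ^ m), ← zpow_mul]
    rw [map_mul, map_pow] at hc
    rw [eq_inv_of_mul_eq_one_left hc, map_inv₀, map_inv₀]
    simp only [unitVal, Units.val_mk0]
    rw [mul_comm (v (algebraMap K L c))⁻¹, inv_mul_cancel_left₀ hf1]

/-- `vL` is generated over `vK` by the values of a set. -/
lemma valGroup_le_sup_closure {S : Set L} (hS : (0 : L) ∉ S) {f : L} (hf0 : f ≠ 0)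
    (h : ∀ y : L, y ≠ 0 → ∃ r ∈ S, ∃ s ∈ S, ∃ (c : K) (m : ℤ),
      v y = v (algebraMap K L c * (r / s * f ^ m))) :
    valGroup v ≤ valGroup (restr K v) ⊔
      Subgroup.closure ({γ | ∃ y ∈ insert f S, v y = (γ : Γ)} : Set Γˣ) := by
  intro γ hγ
  obtain ⟨y, hy⟩ := (mem_valGroup_iff v).1 hγ
  have hy0 : y ≠ 0 := by
    rintro rfl; rw [map_zero] at hy; exact γ.ne_zero hy.symm
  obtain ⟨r, hr, s, hs, c, m, he⟩ := h y hy0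
  have hr0 : r ≠ 0 := fun h0 => hS (h0 ▸ hr)
  have hs0 : s ≠ 0 := fun h0 => hS (h0 ▸ hs)
  have hc0 : c ≠ 0 := by
    rintro rfl; simp only [map_zero, zero_mul] at he; exact hy0 ((Valuation.zero_iff v).1 he)
  have hmem : ∀ (z : L) (hz : z ≠ 0), z ∈ insert f S → unitVal v z hz ∈
      Subgroup.closure ({γ | ∃ y ∈ insert f S, v y = (γ : Γ)} : Set Γˣ) :=
    fun z hz h => Subgroup.subset_closure ⟨z, h, rfl⟩
  refine Subgroup.mem_sup.2 ⟨unitVal (restr K v) c hc0, unitVal_mem _ _ _,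
    unitVal v r hr0 / unitVal v s hs0 * unitVal v f hf0 ^ m, ?_, ?_⟩
  · exact mul_mem (div_mem (hmem r hr0 (by simp [hr])) (hmem s hs0 (by simp [hs])))
      (zpow_mem (hmem f hf0 (by simp)) _)
  · ext
    rw [← hy, he, map_mul, map_mul, map_div₀, map_zpow₀]
    simp [unitVal]

lemma finite_values {S : Set L} (hS : S.Finite) : ({γ | ∃ y ∈ S, v y = (γ : Γ)} : Set Γˣ).Finite := by
  have hinj : Function.Injective (Units.val : Γˣ → Γ) := Units.val_injective
  refine Set.Finite.of_finite_image ((hS.image v).subset ?_) hinj.injOn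
  rintro _ ⟨γ, ⟨y, hy, h⟩, rfl⟩
  exact ⟨y, hy, h⟩

lemma countable_values {S : Set L} (hS : S.Countable) :
    ({γ | ∃ y ∈ S, v y = (γ : Γ)} : Set Γˣ).Countable := by
  refine Set.countable_of_injective_of_countable_image (f := Units.val) Units.val_injective.injOn
    ((hS.image v).mono ?_)
  rintro _ ⟨γ, ⟨y, hy, h⟩, rfl⟩
  exact ⟨y, hy, h⟩

lemma values_subset_valGroup {S : Set L} :
    ({γ | ∃ y ∈ S, v y = (γ : Γ)} : Set Γˣ) ⊆ valGroup v := by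
  rintro γ ⟨y, -, h⟩
  exact (mem_valGroup_iff v).2 ⟨y, h⟩

end ValueGroups

/-! ### Value group and residue field in one variable. -/

section DigitSpace

variable {K : Type u} {L : Type w} {Γ : Type g} [Field K] [Field L] [Algebra K L]
  [LinearOrderedCommGroupWithZero Γ] {v : Valuation L Γ}

lemma res_zpow {x : L} (hx : v x = 1) (m : ℤ) : res v (x ^ m) = res v x ^ m := by
  cases m with
  | ofNat m => simpa using res_pow hx.le m
  | negSucc m =>
    rw [zpow_negSucc, zpow_negSucc, res_inv (by rw [map_pow, hx, one_pow]), res_pow hx.le]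

namespace IsDigitSpace

variable {f : L} {D : Submodule K L} (hD : IsDigitSpace K v f D)

include hD

/-- Factor out a maximal term. By `le_val_sum` the cofactor `y` has value 1, and its residue is a
sum of residues of monomials of value 1, since the smaller terms vanish. -/
lemma exists_eq_mul_of_sum (E : IntermediateField (ResField (restr K v)) (ResField v))
    (hE : ∀ x, (∃ a ∈ D, Sim v x a) → ∀ m : ℤ, v (x * f ^ m) = 1 → res v (x * f ^ m) ∈ E)
    (s : Finset ℕ) (a : ℕ → L) (ha : ∀ i ∈ s, a i ∈ D) (hne : ∑ i ∈ s, a i * f ^ i ≠ 0) :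
    ∃ x, (∃ a ∈ D, Sim v x a) ∧ ∃ (m : ℤ) (y : L), v y = 1 ∧ res v y ∈ E ∧
      ∑ i ∈ s, a i * f ^ i = x * f ^ m * y := by
  have hf0 := hD.ne_zero
  have hs : s.Nonempty := by
    rw [Finset.nonempty_iff_ne_empty]; rintro rfl; simp at hne
  obtain ⟨j, hj, hmax⟩ := s.exists_max_image (fun i => v (a i * f ^ i)) hs
  have hval : v (∑ i ∈ s, a i * f ^ i) = v (a j * f ^ j) :=
    le_antisymm (v.map_sum_le hmax)
      (le_val_sum hf0 hD.not_isAlgType s (fun i hi => hD.isAlgType_or (ha i hi)) hj)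
  have hm0 : a j * f ^ j ≠ 0 := by
    rw [← Valuation.ne_zero_iff v, ← hval, Valuation.ne_zero_iff]; exact hne
  have haj : a j ≠ 0 := left_ne_zero_of_mul hm0
  have hle : ∀ i ∈ s, v (a i * f ^ i / (a j * f ^ j)) ≤ 1 := fun i hi => by
    rw [map_div₀]; exact div_le_one_of_le₀ (hmax i hi) zero_le
  refine ⟨a j, ⟨a j, ha j hj, .refl haj⟩, j, (∑ i ∈ s, a i * f ^ i) / (a j * f ^ j), ?_, ?_, ?_⟩
  · rw [map_div₀, hval, div_self ((Valuation.ne_zero_iff v).2 hm0)]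
  · rw [Finset.sum_div, res_sum s hle]
    refine sum_mem fun i hi => ?_
    rcases (hle i hi).lt_or_eq with h1 | h1
    · rw [(res_eq_zero_iff h1.le).2 h1]; exact zero_mem E
    have hai : a i ≠ 0 := by rintro h0; simp [h0] at h1
    have e : a i * f ^ i / (a j * f ^ j) = a i / a j * f ^ ((i : ℤ) - j) := by
      rw [zpow_sub₀ hf0, zpow_natCast, zpow_natCast]; field_simp
    rw [e] at h1 ⊢
    exact hE _ (hD.sim_div ⟨_, ha i hi, .refl hai⟩ ⟨_, ha j hj, .refl haj⟩) _ h1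
  · rw [zpow_natCast]; field_simp

lemma exists_eq_mul (E : IntermediateField (ResField (restr K v)) (ResField v))
    (hE : ∀ x, (∃ a ∈ D, Sim v x a) → ∀ m : ℤ, v (x * f ^ m) = 1 → res v (x * f ^ m) ∈ E)
    {z : L} (hz : z ≠ 0) :
    ∃ x, (∃ a ∈ D, Sim v x a) ∧ ∃ (m : ℤ) (y : L), v y = 1 ∧ res v y ∈ E ∧
      z = x * f ^ m * y := by
  obtain ⟨s, s', a, a', ha, ha', hne, rfl⟩ := hD.exists_eq_div z
  obtain ⟨x', hx', m', y', hy', hr', h'⟩ := hD.exists_eq_mul_of_sum E hE s' a' ha' hne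
  obtain ⟨x, hx, m, y, hy, hr, h⟩ := hD.exists_eq_mul_of_sum E hE s a ha
    (by rintro h0; simp [h0] at hz)
  refine ⟨x / x', hD.sim_div hx hx', m - m', y / y', by rw [map_div₀, hy, hy', div_one], ?_, ?_⟩
  · rw [div_eq_mul_inv, res_mul hy.le (by rw [map_inv₀, hy', inv_one]), res_inv hy']
    exact mul_mem hr (inv_mem hr')
  · rw [h, h', zpow_sub₀ hD.ne_zero]
    field_simp

/-- The residue field is generated by the residues of monomials of value 1; both cases for `f` use
this criterion. -/
lemma eq_top_of_forall_res_mem (E : IntermediateField (ResField (restr K v)) (ResField v))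
    (hE : ∀ x, (∃ a ∈ D, Sim v x a) → ∀ m : ℤ, v (x * f ^ m) = 1 → res v (x * f ^ m) ∈ E) :
    E = ⊤ := by
  rw [eq_top_iff]
  rintro z -
  obtain ⟨y, hy, rfl⟩ := exists_res_eq z
  rcases hy.lt_or_eq with h1 | h1
  · rw [(res_eq_zero_iff h1.le).2 h1]; exact zero_mem E
  obtain ⟨x, hx, m, u, hu, hr, rfl⟩ := hD.exists_eq_mul E hE (z := y) (by rintro rfl; simp at h1)
  have h2 : v (x * f ^ m) = 1 := by rwa [map_mul, hu, mul_one] at h1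
  rw [res_mul h2.le hu.le]
  exact mul_mem (hE x hx m h2) hr

lemma exists_val_eq {y : L} (hy : y ≠ 0) : ∃ a ∈ D, a ≠ 0 ∧ ∃ m : ℤ, v y = v (a * f ^ m) := by
  obtain ⟨x, ⟨a, ha, hs⟩, m, u, hu, -, rfl⟩ := hD.exists_eq_mul ⊤ (fun _ _ _ _ => trivial) hy
  exact ⟨a, ha, hs.right_ne_zero, m, by rw [map_mul, hu, mul_one, map_mul, hs.val_eq, ← map_mul]⟩

lemma valGroup_fg : ∃ S : Set Γˣ, S.Finite ∧ S ⊆ valGroup v ∧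
    valGroup v ≤ valGroup (restr K v) ⊔ Subgroup.closure S := by
  have := hD.finite
  obtain ⟨R, hRD, h0, hcard, hR⟩ := exists_set_val_representatives v D
  have hfin : R.Finite :=
    Cardinal.lt_aleph0_iff_set_finite.1 (lt_of_le_of_lt hcard (Module.rank_lt_aleph0 K D))
  refine ⟨_, finite_values (hfin.insert f), values_subset_valGroup,
    valGroup_le_sup_closure (K := K) h0 hD.ne_zero fun y hy => ?_⟩
  obtain ⟨a, ha, ha0, m, h⟩ := hD.exists_val_eq hy
  obtain ⟨r, hr, c, hc⟩ := hR a ha ha0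
  -- The generation criterion asks for a quotient of representatives; the denominator is the one
  -- chosen for the coset of 1.
  obtain ⟨s, hs, d, hd⟩ := hR 1 hD.one_mem one_ne_zero
  refine ⟨r, hr, s, hs, c / d, m, ?_⟩
  have e : algebraMap K L (c / d) * (r / s * f ^ m) =
      algebraMap K L c * r * f ^ m / (algebraMap K L d * s) := by
    rw [map_div₀, div_mul_eq_mul_div, ← mul_assoc, mul_div_assoc', mul_comm (algebraMap K L d) s,
      ← div_div]
    ring
  rw [e, map_div₀, ← hd, map_mul v _ (f ^ m), ← hc, map_one, div_one, h, map_mul]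

/-- For nontorsion `f`, a monomial of value 1 has exponent 0, so only digits yield residues. -/
lemma digitField_eq_top (hf : IsNontorsion K v f) : hD.digitField = ⊤ := by
  refine hD.eq_top_of_forall_res_mem _ fun x hx m h => ?_
  obtain rfl := hf.eq_zero_of_isAlgType (hD.isAlgType_of_sim hx) h
  rw [zpow_zero, mul_one] at h ⊢
  exact hD.res_mem_digitField hx h.le

lemma rationalRank_eq_one (hf : IsNontorsion K v f) : rationalRank (ValQuot K v) = 1 :=
  rationalRank_valQuot_eq_one K hD.ne_zero hf fun y hy => by
    obtain ⟨a, ha, ha0, m, h⟩ := hD.exists_val_eq hy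
    exact ⟨a, m, hD.isAlgType a ha ha0, h⟩

lemma rationalRank_eq_zero (hf : ¬ IsNontorsion K v f) : rationalRank (ValQuot K v) = 0 := by
  rw [rationalRank_valQuot_eq_zero_iff]
  intro y hy
  obtain ⟨a, ha, ha0, m, h⟩ := hD.exists_val_eq hy
  obtain ⟨e, he, c, hc, -⟩ := hD.isAlgType a ha ha0
  obtain ⟨e', he', c', hc'⟩ := exists_pow_of_not_isNontorsion hf
  -- The relation for `a` is raised to the power `e'`, the one for `f` to the power `m * e`.
  refine ⟨e * e', Nat.mul_pos he he', c ^ e' * c' ^ (m * e), ?_⟩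
  have e1 : v (algebraMap K L (c ^ e' * c' ^ (m * e))) =
      v (algebraMap K L c) ^ e' * v (algebraMap K L c') ^ (m * e) := by simp
  rw [map_mul, e1, map_pow, h, map_mul, map_zpow₀]
  rw [map_mul, map_pow] at hc hc'
  have e2 : (v a * v f ^ m) ^ (e * e') = (v a ^ e) ^ e' * (v f ^ e') ^ (m * e) := by
    rw [mul_pow, pow_mul, ← zpow_natCast (v f ^ m), ← zpow_mul, ← zpow_natCast (v f) e',
      ← zpow_mul]
    congr 2
    push_cast; ring
  rw [e2, mul_mul_mul_comm, ← mul_pow, ← mul_zpow, hc, hc', one_pow, one_zpow, one_mul]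

/-- The ruled residue theorem. -/
lemma isRationalFunctionField_digitField (hf : ¬ IsNontorsion K v f) :
    IsRationalFunctionField hD.digitField (ResField v) 1 := by
  classical
  -- Take the least positive `e` for which `f ^ e` can be scaled to value 1 by an element with the
  -- leading term of a digit. Minimality forces `e ∣ m` for every monomial `x * f ^ m` of value 1,
  -- so its residue is a digit residue times a power of `t`.
  have hex : ∃ e : ℕ, 0 < e ∧ ∃ x, (∃ a ∈ D, Sim v x a) ∧ v (f ^ e * x) = 1 := by
    obtain ⟨e, he, c, hc⟩ := exists_pow_of_not_isNontorsion hf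
    exact ⟨e, he, _, hD.sim_base (c := c) (by rintro rfl; simp at hc), hc⟩
  obtain ⟨he, b, hb, hfb⟩ := Nat.find_spec hex
  have hmin : ∀ r < Nat.find hex, ∀ x, (∃ a ∈ D, Sim v x a) → v (f ^ r * x) = 1 → r = 0 := by
    intro r hr x hx h1
    by_contra hr0
    exact Nat.find_min hex hr ⟨Nat.pos_of_ne_zero hr0, x, hx, h1⟩
  set e := Nat.find hex
  set t := res v (f ^ e * b) with ht
  have htr := transcendental_res hD.not_isAlgType he (hD.isAlgType_of_sim hb) hfb
  have htr' : Transcendental hD.digitField t := by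
    have := hD.finiteDimensional_digitField
    intro h
    exact htr (h.restrictScalars (ResField (restr K v)))
  refine ⟨fun _ => t, ?_, ?_⟩
  · rw [algebraicIndependent_unique_type_iff]; exact htr'
  rw [Set.range_const]
  have key : (IntermediateField.adjoin hD.digitField {t}).restrictScalars
      (ResField (restr K v)) = ⊤ := by
    refine hD.eq_top_of_forall_res_mem _ fun x hx m h => ?_
    have hb0 := (hD.isAlgType_of_sim hb).ne_zero
    have hf0 := hD.ne_zero
    obtain ⟨r, hr⟩ : ∃ r : ℕ, (r : ℤ) = m % e :=
      ⟨(m % e).toNat, Int.toNat_of_nonneg (Int.emod_nonneg _ (by exact_mod_cast he.ne'))⟩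
    have hm : m = e * (m / e) + r := by rw [hr]; exact (Int.mul_ediv_add_emod m e).symm
    have hre : r < e := by
      have := Int.emod_lt_of_pos m (show (0 : ℤ) < e by exact_mod_cast he)
      rw [← hr] at this; exact_mod_cast this
    have hx' := hD.sim_div hx (hD.sim_zpow hb (m / e))
    have hfbm : v ((f ^ e * b) ^ (m / e)) = 1 := by rw [map_zpow₀, hfb, one_zpow]
    have e1 : x * f ^ m = f ^ r * (x / b ^ (m / e)) * (f ^ e * b) ^ (m / e) := by
      conv_lhs => rw [hm]
      rw [zpow_add₀ hf0, zpow_mul, zpow_natCast, zpow_natCast, mul_zpow]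
      field_simp
    rw [e1, map_mul, hfbm, mul_one] at h
    obtain rfl := hmin r hre _ hx' h
    rw [pow_zero, one_mul] at h e1
    rw [e1, res_mul h.le hfbm.le, res_zpow hfb]
    change _ ∈ IntermediateField.adjoin hD.digitField {t}
    refine mul_mem ?_ (zpow_mem (IntermediateField.mem_adjoin_simple_self _ t) _)
    exact (IntermediateField.adjoin hD.digitField {t}).algebraMap_mem
      ⟨_, hD.res_mem_digitField hx' h.le⟩
  rw [eq_top_iff]
  rintro z -
  have : z ∈ (IntermediateField.adjoin hD.digitField {t}).restrictScalars
      (ResField (restr K v)) := by rw [key]; trivial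
  exact this

end IsDigitSpace

/-- In `K(x)`, either all elements are of algebraic type or there is a digit space. -/
lemma exists_isDigitSpace {x : L} (hx : Transcendental K x)
    (hgen : ∀ y : L, ∃ p q : Polynomial K, q ≠ 0 ∧
      y = Polynomial.aeval x p / Polynomial.aeval x q) :
    (∀ y : L, y ≠ 0 → IsAlgType K v y) ∨
    ∃ f D, IsDigitSpace K v f D ∧ ∀ a ∈ D, ∃ p : Polynomial K, Polynomial.aeval x p = a ∧
      ∀ q : Polynomial K, q ≠ 0 → ¬ IsAlgType K v (Polynomial.aeval x q) → p.degree < q.degree := by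
  classical
  have hinj : Function.Injective (Polynomial.aeval (R := K) x) :=
    transcendental_iff_injective.1 hx
  have hx0 : ∀ {p : Polynomial K}, p ≠ 0 → Polynomial.aeval x p ≠ 0 := fun hp h =>
    hp (hinj (by rw [h, map_zero]))
  by_cases hall : ∀ p : Polynomial K, p ≠ 0 → IsAlgType K v (Polynomial.aeval x p)
  · left
    intro y hy
    obtain ⟨p, q, hq, rfl⟩ := hgen y
    exact (hall p (by rintro rfl; simp at hy)).div (hall q hq)
  right
  push Not at hall
  -- The least-degree polynomial whose value at `x` is not of algebraic type supplies `f`; every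
  -- nonzero polynomial of smaller degree is then a digit of algebraic type.
  obtain ⟨p, ⟨hp0, hp⟩, hmin⟩ := Polynomial.degree_lt_wf.has_min
    {p : Polynomial K | p ≠ 0 ∧ ¬ IsAlgType K v (Polynomial.aeval x p)} hall
  have hmin' : ∀ q : Polynomial K, q ≠ 0 → q.degree < p.degree →
      IsAlgType K v (Polynomial.aeval x q) := by
    intro q hq hlt
    by_contra h
    exact hmin q ⟨hq, h⟩ hlt
  have hdeg : 0 < p.degree := by
    by_contra! h
    rw [Polynomial.eq_C_of_degree_le_zero h] at hp hp0
    rw [Polynomial.aeval_C] at hp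
    exact hp (.of_base fun h0 => hp0 (by rw [h0, map_zero]))
  let D : Submodule K L := (Polynomial.degreeLT K p.natDegree).map (Polynomial.aeval x).toLinearMap
  have hmem : ∀ {a : L}, a ∈ D ↔ ∃ q : Polynomial K, q.degree < p.degree ∧
      Polynomial.aeval x q = a := by
    intro a
    simp only [D, Submodule.mem_map, Polynomial.mem_degreeLT, Polynomial.degree_eq_natDegree hp0]
    rfl
  have hexp : ∀ q : Polynomial K, ∃ (n : ℕ) (a : ℕ → L), (∀ i, a i ∈ D) ∧
      Polynomial.aeval x q = ∑ i ∈ Finset.range n, a i * Polynomial.aeval x p ^ i := by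
    intro q
    induction q using Polynomial.degree_lt_wf.induction with
    | _ q ih =>
    by_cases hq : q.degree < p.degree
    · refine ⟨1, fun _ => Polynomial.aeval x q, fun _ => hmem.2 ⟨q, hq, rfl⟩, by simp⟩
    · have hq0 : q ≠ 0 := by rintro rfl; simp [bot_lt_iff_ne_bot, hp0] at hq
      obtain ⟨n, a, ha, h⟩ := ih (q / p) (Polynomial.degree_div_lt hq0 hdeg)
      -- The remainder becomes the digit at place 0, and the expansion of the quotient is shifted by
      -- one.
      refine ⟨n + 1, fun i => Nat.casesOn i (Polynomial.aeval x (q % p)) a, ?_, ?_⟩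
      · rintro (_ | i)
        · exact hmem.2 ⟨_, EuclideanDomain.mod_lt q hp0, rfl⟩
        · exact ha i
      · rw [Finset.sum_range_succ']
        simp only [pow_zero, mul_one, pow_succ, ← mul_assoc]
        rw [← Finset.sum_mul, ← h, ← map_mul]
        change _ = _ + Polynomial.aeval x (q % p)
        rw [← map_add]
        congr 1
        rw [mul_comm]; exact (EuclideanDomain.div_add_mod q p).symm
  refine ⟨Polynomial.aeval x p, D, ⟨hp, hx0 hp0, ?_, ?_, ?_, ?_, ?_⟩, ?_⟩
  · have : Module.Finite K (Polynomial.degreeLT K p.natDegree) :=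
      Module.Finite.equiv (Polynomial.degreeLTEquiv K p.natDegree).symm
    exact Module.Finite.map _ _
  · intro a ha ha0
    obtain ⟨q, hq, rfl⟩ := hmem.1 ha
    exact hmin' q (by rintro rfl; simp at ha0) hq
  · exact hmem.2 ⟨1, by simpa using hdeg, by simp⟩
  · intro a ha b hb
    obtain ⟨q, hq, rfl⟩ := hmem.1 ha
    obtain ⟨r, hr, rfl⟩ := hmem.1 hb
    refine ⟨_, hmem.2 ⟨q * r / p, ?_, rfl⟩, _, hmem.2 ⟨q * r % p, EuclideanDomain.mod_lt _ hp0, rfl⟩,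
      ?_⟩
    -- Both factors have degree below that of `p`, so the product has degree below twice that, and
    -- the quotient is a digit again.
    · by_cases hlt : (q * r).degree < p.degree
      · rw [(Polynomial.div_eq_zero_iff hp0).2 hlt]
        simpa [bot_lt_iff_ne_bot] using hp0
      · push Not at hlt
        by_contra! h
        have h1 := Polynomial.degree_add_div hp0 hlt
        have hqr0 : q * r ≠ 0 := by
          intro h0
          rw [h0, Polynomial.degree_zero, le_bot_iff, Polynomial.degree_eq_bot] at hlt
          exact hp0 hlt
        have hd0 : q * r / p ≠ 0 := by
          intro h0
          rw [h0, Polynomial.degree_zero, le_bot_iff, Polynomial.degree_eq_bot] at h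
          exact hp0 h
        rw [Polynomial.degree_mul, Polynomial.degree_eq_natDegree hp0,
          Polynomial.degree_eq_natDegree hd0,
          Polynomial.degree_eq_natDegree (left_ne_zero_of_mul hqr0),
          Polynomial.degree_eq_natDegree (right_ne_zero_of_mul hqr0)] at h1
        rw [Polynomial.degree_eq_natDegree hp0, Polynomial.degree_eq_natDegree hd0] at h
        rw [Polynomial.degree_eq_natDegree hp0,
          Polynomial.degree_eq_natDegree (left_ne_zero_of_mul hqr0)] at hq
        rw [Polynomial.degree_eq_natDegree hp0,
          Polynomial.degree_eq_natDegree (right_ne_zero_of_mul hqr0)] at hr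
        norm_cast at h1 h hq hr
        omega
    · rw [← map_mul, ← map_mul, ← map_add]
      congr 1
      rw [mul_comm (q * r / p)]; exact (EuclideanDomain.div_add_mod _ p).symm
  · intro y
    obtain ⟨q, r, hr, rfl⟩ := hgen y
    obtain ⟨n, a, ha, h⟩ := hexp q
    obtain ⟨n', a', ha', h'⟩ := hexp r
    exact ⟨Finset.range n, Finset.range n', a, a', fun i _ => ha i, fun i _ => ha' i,
      h' ▸ hx0 hr, by rw [← h, ← h']⟩
  · intro a ha
    obtain ⟨q, hq, rfl⟩ := hmem.1 ha
    exact ⟨q, rfl, fun r hr hra => lt_of_lt_of_le hq (not_lt.1 (hmin r ⟨hr, hra⟩))⟩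

/-- If `v` is trivial on `K` and `vK(x)` is not torsion, the residue field is a simple extension. -/
lemma IsDigitSpace.exists_adjoin_simple_eq_top {f : L} {D : Submodule K L}
    (hD : IsDigitSpace K v f D) (hf : IsNontorsion K v f) {x : L}
    (hdeg : ∀ a ∈ D, ∃ p : Polynomial K, Polynomial.aeval x p = a ∧
      ∀ q : Polynomial K, q ≠ 0 → ¬ IsAlgType K v (Polynomial.aeval x q) → p.degree < q.degree)
    (htriv : IsTrivialOn K v) :
    ∃ z : ResField v, IntermediateField.adjoin (ResField (restr K v)) {z} = ⊤ := by
  have hc : ∀ c : K, v (algebraMap K L c) ≤ 1 := fun c => by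
    by_cases h : c = 0
    · simp [h]
    · exact (htriv c h).le
  have hbase : ∀ (E : IntermediateField (ResField (restr K v)) (ResField v)) (c : K),
      res v (algebraMap K L c) ∈ E := fun E c => by
    rw [← algebraMap_res (hc c)]; exact E.algebraMap_mem _
  -- If `v x ≤ 1`, residues of polynomials in `x` are polynomials in `res v x`. If `v x > 1`, then
  -- `x` is itself not of algebraic type, so all digits are constants, and the generator is the
  -- default value 0.
  refine ⟨res v x, ?_⟩
  rw [eq_top_iff, ← hD.digitField_eq_top hf]
  rintro z ⟨a, ha, hva, rfl⟩
  obtain ⟨p, rfl, hp⟩ := hdeg a ha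
  rcases le_or_gt (v x) 1 with hx1 | hx1
  · have h1 : ∀ i ∈ p.support, v (algebraMap K L (p.coeff i) * x ^ i) ≤ 1 := fun i _ => by
      rw [map_mul, map_pow]; exact mul_le_one' (hc _) (pow_le_one' hx1 i)
    rw [Polynomial.aeval_eq_sum_range' (Nat.lt_succ_self _)]
    simp only [Algebra.smul_def]
    have h1 : ∀ i ∈ Finset.range p.natDegree.succ,
        v (algebraMap K L (p.coeff i) * x ^ i) ≤ 1 := fun i _ => by
      rw [map_mul, map_pow]; exact mul_le_one' (hc _) (pow_le_one' hx1 i)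
    rw [res_sum _ h1]
    refine sum_mem fun i _ => ?_
    rw [res_mul (hc _) (by rw [map_pow]; exact pow_le_one' hx1 i), res_pow hx1]
    exact mul_mem (hbase _ _) (pow_mem (IntermediateField.mem_adjoin_simple_self _ _) i)
  · have hxa : ¬ IsAlgType K v x := by
      rintro ⟨e, he, c, h, -⟩
      have hc0 : c ≠ 0 := by rintro rfl; simp at h
      rw [map_mul, htriv c hc0, mul_one, map_pow] at h
      exact (one_lt_pow' hx1 he.ne').ne' h
    have := hp Polynomial.X Polynomial.X_ne_zero (by simpa using hxa)
    rw [Polynomial.degree_X] at this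
    have hp0 : p.degree ≤ 0 := Nat.WithBot.lt_one_iff_le_zero.1 this
    rw [Polynomial.eq_C_of_degree_le_zero hp0, Polynomial.aeval_C]
    exact hbase _ _

end DigitSpace

/-! ### Rational function fields and towers. -/

section RationalFunctionFields

open IntermediateField

variable {k : Type u} {E : Type w} [Field k] [Field E] [Algebra k E]

lemma isRationalFunctionField_adjoin {m : ℕ} {x : Fin m → E} (hx : AlgebraicIndependent k x) :
    IsRationalFunctionField k (adjoin k (Set.range x)) m := by
  refine ⟨fun i => ⟨x i, subset_adjoin k _ ⟨i, rfl⟩⟩, ?_, ?_⟩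
  · refine AlgebraicIndependent.of_comp (adjoin k (Set.range x)).val ?_
    exact hx
  · apply IntermediateField.map_injective (adjoin k (Set.range x)).val
    rw [adjoin_map, ← Set.range_comp, ← AlgHom.fieldRange_eq_map, fieldRange_val]
    rfl

lemma IsRationalFunctionField.isTranscendenceBasis {m : ℕ} {x : Fin m → E}
    (hx : AlgebraicIndependent k x) (h : adjoin k (Set.range x) = ⊤) :
    IsTranscendenceBasis k x := by
  rw [hx.isTranscendenceBasis_iff_isAlgebraic]
  rw [← isAlgebraic_adjoin_iff_top]
  refine ⟨fun y => ?_⟩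
  have hy : y ∈ adjoin k (Set.range x) := by rw [h]; trivial
  exact isAlgebraic_algebraMap (⟨y, hy⟩ : adjoin k (Set.range x))

lemma IsRationalFunctionField.trdeg_eq {m : ℕ} (h : IsRationalFunctionField k E m) :
    Algebra.trdeg k E = m := by
  obtain ⟨x, hx, hg⟩ := h
  have := (isTranscendenceBasis hx hg).lift_cardinalMk_eq_trdeg
  simpa using this.symm

lemma IsRationalFunctionField.essFiniteType {m : ℕ} (h : IsRationalFunctionField k E m) :
    Algebra.EssFiniteType k E := by
  classical
  obtain ⟨x, -, hg⟩ := h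
  rw [← fg_top_iff]
  exact ⟨Finset.univ.image x, by rw [← hg]; congr 1; simp⟩

lemma IsRationalFunctionField.exists_transcendental (h : IsRationalFunctionField k E 1) :
    ∃ x : E, Transcendental k x ∧ ∀ y : E, ∃ p q : Polynomial k, q ≠ 0 ∧
      y = Polynomial.aeval x p / Polynomial.aeval x q := by
  obtain ⟨x, hx, hg⟩ := h
  refine ⟨x 0, hx.transcendental 0, fun y => ?_⟩
  have hr : Set.range x = {x 0} := by
    ext z; simp [Fin.exists_fin_one, eq_comm]
  have hy : y ∈ adjoin k {x 0} := by rw [← hr, hg]; trivial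
  obtain ⟨p, q, hpq⟩ := (mem_adjoin_simple_iff k y).1 hy
  by_cases hq : q = 0
  · exact ⟨0, 1, one_ne_zero, by rw [hpq, hq]; simp⟩
  · exact ⟨p, q, hq, hpq⟩

/-- A rational function field in `n + 1` variables is one in one variable over one in `n`. -/
lemma IsRationalFunctionField.exists_tower {n : ℕ} (h : IsRationalFunctionField k E (n + 1)) :
    ∃ F : IntermediateField k E, IsRationalFunctionField k F n ∧ IsRationalFunctionField F E 1 := by
  obtain ⟨x, hx, hg⟩ := h
  have hx' : AlgebraicIndependent k (x ∘ Fin.castSucc) := hx.comp _ (Fin.castSucc_injective n)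
  refine ⟨adjoin k (Set.range (x ∘ Fin.castSucc)), isRationalFunctionField_adjoin hx',
    fun _ => x (Fin.last n), ?_, ?_⟩
  · rw [algebraicIndependent_unique_type_iff, transcendental_adjoin_iff]
    have := hx.transcendental_adjoin (s := Set.range Fin.castSucc) (i := Fin.last n) (by
      rintro ⟨i, hi⟩; exact (Fin.castSucc_lt_last i).ne hi)
    rwa [← Set.range_comp] at this
  · rw [Set.range_const]
    have h1 := adjoin_adjoin_left k (Set.range (x ∘ Fin.castSucc)) {x (Fin.last n)}
    have h2 : Set.range (x ∘ Fin.castSucc) ∪ {x (Fin.last n)} = Set.range x := by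
      ext z
      constructor
      · rintro (⟨i, rfl⟩ | rfl)
        · exact ⟨_, rfl⟩
        · exact ⟨_, rfl⟩
      · rintro ⟨i, rfl⟩
        induction i using Fin.lastCases with
        | last => right; rfl
        | cast i => left; exact ⟨i, rfl⟩
    rw [h2, hg] at h1
    exact restrictScalars_injective k (h1.trans rfl)

variable {E' : Type w} [Field E'] [Algebra k E'] [Algebra E E'] [IsScalarTower k E E']

/-- A finite extension of `E` stays finitely generated over `k` and has the same transcendence
degree, so `F` can serve as the field of constants. -/
lemma isRationalOverFG_of_tower [Algebra.EssFiniteType k E] {m : ℕ}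
    (hm : Algebra.trdeg k E = m) (F : IntermediateField E E') [FiniteDimensional E F]
    (h : IsRationalFunctionField F E' 1) : IsRationalOverFG k E' (m + 1) := by
  refine ⟨F.restrictScalars k, ?_, ?_, h⟩
  · rw [← essFiniteType_iff]
    exact Algebra.EssFiniteType.comp k E F
  · have h1 : Algebra.trdeg k F = m := by
      rw [← trdeg_add_eq k E (A := F), hm, trdeg_eq_zero, add_zero]
    have h2 : Algebra.trdeg k (F.restrictScalars k) = m := h1
    rw [h2]; simp

lemma trdeg_eq_one_of_finiteDimensional (F : IntermediateField E E') [FiniteDimensional E F]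
    (h : IsRationalFunctionField F E' 1) : Algebra.trdeg E E' = 1 := by
  rw [← trdeg_add_eq E F (A := E'), h.trdeg_eq, trdeg_eq_zero]; simp

lemma essFiniteType_of_finiteDimensional (F : IntermediateField E E') [FiniteDimensional E F]
    (h : IsRationalFunctionField F E' 1) : Algebra.EssFiniteType E E' := by
  have := h.essFiniteType
  exact Algebra.EssFiniteType.comp E F E'

/-- If `E | k` is generated by algebraically independent elements, as is the case if `K → k` and
`F → E` are onto for a rational function field `F | K`, then a finite simple extension of `E` is
a simple algebraic extension of a rational function field over `k`. -/
lemma isSimpleAlgebraicOverRational_of_tower {K : Type u} {F : Type w} [Field K] [Field F]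
    [Algebra K F] {m : ℕ} (hF : IsRationalFunctionField K F m) (f : K →+* k)
    (hf : Function.Surjective f) (φ : F →+* E) (hφ : Function.Surjective φ)
    (hcomm : (algebraMap k E).comp f = φ.comp (algebraMap K F)) [Algebra.IsAlgebraic E E']
    {z : E'} (hz : adjoin E {z} = ⊤) : IsSimpleAlgebraicOverRational k E' m := by
  obtain ⟨x, hx, hg⟩ := hF
  let ψ : F →+* E' := (algebraMap E E').comp φ
  have hcomm' : (algebraMap k E').comp f = ψ.comp (algebraMap K F) := by
    rw [IsScalarTower.algebraMap_eq k E E', RingHom.comp_assoc, hcomm, RingHom.comp_assoc]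
  have hy : AlgebraicIndependent k (ψ ∘ x) := hx.ringHom_of_comp_eq f ψ hf ψ.injective hcomm'
  let F' := adjoin k (Set.range (ψ ∘ x))
  have hE : ∀ e : E, algebraMap E E' e ∈ F' := by
    intro e
    obtain ⟨y, rfl⟩ := hφ e
    change ψ y ∈ F'
    have hmem : y ∈ adjoin K (Set.range x) := by rw [hg]; trivial
    induction hmem using adjoin_induction with
    | mem y hy => obtain ⟨i, rfl⟩ := hy; exact subset_adjoin k _ ⟨i, rfl⟩
    | algebraMap a =>
      have := congrArg (fun r => r a) hcomm'
      simp only [RingHom.comp_apply] at this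
      rw [← this]; exact F'.algebraMap_mem _
    | add y z _ _ h1 h2 => rw [map_add]; exact add_mem h1 h2
    | inv y _ h1 => rw [map_inv₀]; exact inv_mem h1
    | mul y z _ _ h1 h2 => rw [map_mul]; exact mul_mem h1 h2
  refine ⟨F', isRationalFunctionField_adjoin hy, z, ?_, ?_⟩
  · let i : E →+* F' := (algebraMap E E').codRestrict F' hE
    let _ := i.toAlgebra
    have : IsScalarTower E F' E' := IsScalarTower.of_algebraMap_eq fun _ => rfl
    exact (Algebra.IsAlgebraic.isAlgebraic (R := E) z).tower_top F'
  · rw [eq_top_iff]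
    rintro y -
    have hmem : y ∈ adjoin E {z} := by rw [hz]; trivial
    induction hmem using adjoin_induction with
    | mem y hy => exact subset_adjoin _ _ hy
    | algebraMap a => exact (adjoin F' {z}).algebraMap_mem ⟨_, hE a⟩
    | add y z _ _ h1 h2 => exact add_mem h1 h2
    | inv y _ h1 => exact inv_mem h1
    | mul y z _ _ h1 h2 => exact mul_mem h1 h2

end RationalFunctionFields

/-! ### The trichotomy for one variable. -/

section OneVariable

variable (K : Type u) {L : Type w} {Γ : Type g} [Field K] [Field L] [Algebra K L]
  [LinearOrderedCommGroupWithZero Γ] (v : Valuation L Γ)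

/-- `vL` is generated over `vK` by finitely many elements. -/
def IsValGroupFG : Prop := ∃ S : Set Γˣ, S.Finite ∧ S ⊆ valGroup v ∧
  valGroup v ≤ valGroup (restr K v) ⊔ Subgroup.closure S

variable {K v}

lemma IsValGroupFG.group_fg (h : IsValGroupFG K v) : Group.FG (ValQuot K v) := by
  obtain ⟨S, hfin, hS, hle⟩ := h
  exact group_fg_quotient hS hfin hle

/-- The cases are: every nonzero element is of algebraic type; `f` has nontorsion value; `f` has
torsion value and therefore produces a transcendental residue. -/
theorem trichotomy_of_isRationalFunctionField_one (hL : IsRationalFunctionField K L 1) :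
    (rationalRank (ValQuot K v) = 0 ∧
      Algebra.IsAlgebraic (ResField (restr K v)) (ResField v)) ∨
    (rationalRank (ValQuot K v) = 1 ∧ IsValGroupFG K v ∧
      FiniteDimensional (ResField (restr K v)) (ResField v) ∧
      (IsTrivialOn K v →
        ∃ z : ResField v, IntermediateField.adjoin (ResField (restr K v)) {z} = ⊤)) ∨
    (rationalRank (ValQuot K v) = 0 ∧ IsValGroupFG K v ∧
      ∃ k' : IntermediateField (ResField (restr K v)) (ResField v),
        FiniteDimensional (ResField (restr K v)) k' ∧
        IsRationalFunctionField k' (ResField v) 1) := by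
  obtain ⟨x, hx, hgen⟩ := hL.exists_transcendental
  rcases exists_isDigitSpace (v := v) hx hgen with hall | ⟨f, D, hD, hdeg⟩
  · left
    constructor
    · rw [rationalRank_valQuot_eq_zero_iff]
      intro y hy
      obtain ⟨e, he, c, hc, -⟩ := hall y hy
      exact ⟨e, he, c, hc⟩
    · refine ⟨fun z => ?_⟩
      obtain ⟨y, hy, rfl⟩ := exists_res_eq z
      by_cases hy0 : y = 0
      · simp [hy0, isAlgebraic_zero]
      · exact (hall y hy0).isAlgebraic_res hy
  · right
    by_cases hf : IsNontorsion K v f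
    · left
      refine ⟨hD.rationalRank_eq_one hf, hD.valGroup_fg, ?_,
        hD.exists_adjoin_simple_eq_top hf hdeg⟩
      have := hD.finiteDimensional_digitField
      rw [hD.digitField_eq_top hf] at this
      exact Module.Finite.equiv (IntermediateField.topEquiv.toLinearEquiv :
        (⊤ : IntermediateField (ResField (restr K v)) (ResField v)) ≃ₗ[_] _)
    · right
      exact ⟨hD.rationalRank_eq_zero hf, hD.valGroup_fg, hD.digitField,
        hD.finiteDimensional_digitField, hD.isRationalFunctionField_digitField hf⟩

end OneVariable

/-! ### Valuations in towers. -/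

section Tower

variable {K : Type u} {L : Type w} {Γ : Type g} [Field K] [Field L] [Algebra K L]
  [LinearOrderedCommGroupWithZero Γ] (v : Valuation L Γ)

instance hasExtension_restr_restr (E : IntermediateField K L) :
    (restr K v).HasExtension (restr E v) := instHasExtensionRestr K (restr E v)

instance isScalarTower_resField (E : IntermediateField K L) :
    IsScalarTower (ResField (restr K v)) (ResField (restr E v)) (ResField v) := by
  refine IsScalarTower.of_algebraMap_eq fun z => ?_
  obtain ⟨z, rfl⟩ := IsLocalRing.residue_surjective z
  rfl

variable {v}

lemma rationalRank_valQuot_add (E : IntermediateField K L) : rationalRank (ValQuot K v) =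
    rationalRank (ValQuot E v) + rationalRank (ValQuot K (restr E v)) :=
  rationalRank_add (valGroup_restr_le (restr E v) K) (valGroup_restr_le v E)

lemma IsValGroupFG.trans {E : IntermediateField K L} (h : IsValGroupFG K (restr E v))
    (h' : IsValGroupFG E v) : IsValGroupFG K v := by
  obtain ⟨S, hfin, hS, hle⟩ := h
  obtain ⟨S', hfin', hS', hle'⟩ := h'
  refine ⟨S ∪ S', hfin.union hfin',
    Set.union_subset (hS.trans (valGroup_restr_le v E)) hS', hle'.trans ?_⟩
  refine sup_le (hle.trans (sup_le le_sup_left ?_)) ?_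
  · exact (Subgroup.closure_mono Set.subset_union_left).trans le_sup_right
  · exact (Subgroup.closure_mono Set.subset_union_right).trans le_sup_right

/-- The residue map of a valuation ring which is the whole field. -/
noncomputable def resHom (hv : ∀ y, v y ≤ 1) : L →+* ResField v where
  toFun := res v
  map_one' := res_one
  map_mul' x y := res_mul (hv x) (hv y)
  map_zero' := res_zero
  map_add' x y := res_add (hv x) (hv y)

lemma resHom_surjective (hv : ∀ y, v y ≤ 1) : Function.Surjective (resHom hv) := fun z => by
  obtain ⟨y, -, h⟩ := exists_res_eq z
  exact ⟨y, h⟩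

/-- Here all values of nonzero elements are torsion, and an ordered group has no torsion besides 1.
-/
lemma le_one_of_isTrivialOn (htriv : IsTrivialOn K v) (h : rationalRank (ValQuot K v) = 0) (y : L) :
    v y ≤ 1 := by
  by_cases hy : y = 0
  · simp [hy]
  obtain ⟨e, he, c, hc⟩ := (rationalRank_valQuot_eq_zero_iff K).1 h y hy
  have hc0 : c ≠ 0 := by rintro rfl; simp at hc
  rw [map_mul, htriv c hc0, mul_one, map_pow] at hc
  exact (((pow_eq_one_iff).1 hc).resolve_right he.ne').le

end Tower

/-! ### The Abhyankar inequality and the case of equality. -/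

section Abhyankar

variable {K : Type u} {Γ : Type g} [Field K] [LinearOrderedCommGroupWithZero Γ]

/-- The structure of the value group and the residue field for a rational function field, in the
case of equality in the Abhyankar inequality. -/
structure AbhyankarConclusion {F : Type w} [Field F] [Algebra K F] (v : Valuation F Γ)
    (n ρ τ : ℕ) : Prop where
  valGroup_fg : IsValGroupFG K v
  essFiniteType : Algebra.EssFiniteType (ResField (restr K v)) (ResField v)
  of_rank_one : 1 ≤ n → IsTrivialOn K v → ρ = 1 →
    IsSimpleAlgebraicOverRational (ResField (restr K v)) (ResField v) τ ∨
      IsRationalOverFG (ResField (restr K v)) (ResField v) τ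
  of_rank_zero : 1 ≤ n → n = τ → IsRationalOverFG (ResField (restr K v)) (ResField v) τ

theorem abhyankar (n : ℕ) : ∀ {F : Type w} [Field F] [Algebra K F]
    (_ : IsRationalFunctionField K F n) (v : Valuation F Γ),
    ∃ ρ τ : ℕ, rationalRank (ValQuot K v) = (ρ : Cardinal) ∧
      Algebra.trdeg (ResField (restr K v)) (ResField v) = (τ : Cardinal) ∧
      ρ + τ ≤ n ∧ (n = ρ + τ → AbhyankarConclusion (K := K) v n ρ τ) := by
  induction n with
  | zero =>
    intro F _ _ hF v
    have hsurj : Function.Surjective (algebraMap K F) := by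
      obtain ⟨x, -, hg⟩ := hF
      intro y
      have hy : y ∈ IntermediateField.adjoin K (Set.range x) := by rw [hg]; trivial
      rw [Set.range_eq_empty, IntermediateField.adjoin_empty] at hy
      exact IntermediateField.mem_bot.1 hy
    have hres : Function.Surjective (algebraMap (ResField (restr K v)) (ResField v)) := by
      intro z
      obtain ⟨y, hy, rfl⟩ := exists_res_eq z
      obtain ⟨c, rfl⟩ := hsurj y
      exact ⟨_, algebraMap_res hy⟩
    refine ⟨0, 0, ?_, ?_, le_rfl, fun _ => ⟨?_, ?_, by omega, by omega⟩⟩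
    · rw [Nat.cast_zero, rationalRank_valQuot_eq_zero_iff]
      intro y hy
      obtain ⟨c, rfl⟩ := hsurj y
      refine ⟨1, one_pos, c⁻¹, ?_⟩
      rw [pow_one, map_inv₀, mul_inv_cancel₀ hy, map_one]
    · rw [Nat.cast_zero, trdeg_eq_zero_iff]
      refine ⟨fun z => ?_⟩
      obtain ⟨z, rfl⟩ := hres z
      exact isAlgebraic_algebraMap z
    · refine ⟨∅, Set.finite_empty, Set.empty_subset _, ?_⟩
      refine le_sup_of_le_left fun γ hγ => ?_
      obtain ⟨y, hy⟩ := (mem_valGroup_iff v).1 hγ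
      obtain ⟨c, rfl⟩ := hsurj y
      exact (mem_valGroup_iff _).2 ⟨c, hy⟩
    · have := Algebra.FiniteType.of_surjective (Algebra.ofId (ResField (restr K v)) (ResField v)) hres
      infer_instance
  | succ n ih =>
    intro F _ _ hF v
    obtain ⟨E, hE, hFE⟩ := hF.exists_tower
    obtain ⟨ρ, τ, hρ, hτ, hle, hconc⟩ := ih hE (restr E v)
    -- Restricting to `E` and then to `K` is definitionally the restriction to `K`.
    change Algebra.trdeg (ResField (restr K v)) (ResField (restr E v)) = _ at hτ
    have hrank := rationalRank_valQuot_add (K := K) (v := v) E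
    have htr := trdeg_add_eq (ResField (restr K v)) (ResField (restr E v)) (A := ResField v)
    rw [hρ] at hrank
    rw [hτ] at htr
    rcases trichotomy_of_isRationalFunctionField_one (v := v) hFE with
      ⟨h0, halg⟩ | ⟨h1, hfg, hfin, hsimple⟩ | ⟨h0, hfg, k', hfin, hk'⟩
    · rw [h0, zero_add] at hrank
      rw [trdeg_eq_zero, add_zero] at htr
      -- A variable that contributes nothing rules out equality.
      exact ⟨ρ, τ, hrank, htr.symm, by omega, fun h => by omega⟩
    · rw [h1] at hrank
      rw [trdeg_eq_zero, add_zero] at htr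
      refine ⟨1 + ρ, τ, by rw [hrank]; push_cast; rfl, htr.symm, by omega, fun h => ?_⟩
      obtain ⟨hfg', hess, -, -⟩ := hconc (by omega)
      change Algebra.EssFiniteType (ResField (restr K v)) (ResField (restr E v)) at hess
      refine ⟨hfg'.trans hfg, Algebra.EssFiniteType.comp _ (ResField (restr E v)) _, ?_, by omega⟩
      intro _ htriv hρ1
      left
      -- The last variable provides the whole rational rank, so `v` is trivial on `E`. The residue
      -- map then carries the rational function field `E` onto its residue field, over which `Fv` is
      -- a simple algebraic extension.
      obtain rfl : τ = n := by omega
      obtain rfl : ρ = 0 := by omega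
      have hE1 : ∀ y, restr E v y ≤ 1 :=
        le_one_of_isTrivialOn (K := K) (v := restr E v) htriv (by simpa using hρ)
      have hK1 : ∀ y, restr K v y ≤ 1 := fun y => hE1 (algebraMap K E y)
      have htrivE : IsTrivialOn E v := fun y hy => by
        have h2 : v (algebraMap E F y⁻¹) ≤ 1 := hE1 y⁻¹
        have hy' : v (algebraMap E F y) ≠ 0 := by simpa using hy
        refine le_antisymm (hE1 y) ?_
        rwa [map_inv₀, map_inv₀, inv_le_one₀ (zero_lt_iff.2 hy')] at h2
      obtain ⟨z, hz⟩ := hsimple htrivE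
      refine isSimpleAlgebraicOverRational_of_tower hE (resHom hK1) (resHom_surjective hK1)
        (resHom hE1) (resHom_surjective hE1) ?_ hz
      ext c
      exact algebraMap_res (v := restr E v) (K := K) (hE1 _)
    · rw [h0, zero_add] at hrank
      rw [trdeg_eq_one_of_finiteDimensional k' hk'] at htr
      refine ⟨ρ, τ + 1, hrank, by rw [← htr]; push_cast; rfl, by omega, fun h => ?_⟩
      obtain ⟨hfg', hess, -, -⟩ := hconc (by omega)
      change Algebra.EssFiniteType (ResField (restr K v)) (ResField (restr E v)) at hess
      have := essFiniteType_of_finiteDimensional k' hk'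
      have key := isRationalOverFG_of_tower (k := ResField (restr K v)) hτ k' hk'
      exact ⟨hfg'.trans hfg, Algebra.EssFiniteType.comp _ (ResField (restr E v)) _,
        fun _ _ _ => .inr key, fun _ _ => key⟩

end Abhyankar

/-! ### Countable generation. -/

section Countability

lemma exists_countable_le_span {k : Type u} {κ : Type w} [Field k] [AddCommGroup κ] [Module k κ]
    (W : Submodule k κ) (h : Module.rank k W ≤ Cardinal.aleph0) :
    ∃ B : Set κ, B.Countable ∧ W ≤ Submodule.span k B := by
  let b := Module.Basis.ofVectorSpace k W
  rw [← b.mk_eq_rank'', Cardinal.mk_le_aleph0_iff] at h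
  refine ⟨Set.range fun i => (b i : κ), Set.countable_range _, fun z hz => ?_⟩
  have h1 : (⟨z, hz⟩ : W) ∈ Submodule.span k (Set.range b) := by rw [b.span_eq]; trivial
  have h2 := Submodule.mem_map_of_mem (f := W.subtype) h1
  rw [Submodule.map_span, ← Set.range_comp] at h2
  exact h2

variable {K : Type u} {L : Type w} {Γ : Type g} [Field K] [Field L] [Algebra K L]
  [LinearOrderedCommGroupWithZero Γ] {v : Valuation L Γ}

variable (v) in
/-- The space of residues of the elements of value at most `1` of a subspace. -/
def resSubmodule (V : Submodule K L) : Submodule (ResField (restr K v)) (ResField v) where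
  carrier := {z | ∃ y ∈ V, v y ≤ 1 ∧ res v y = z}
  add_mem' := by
    rintro _ _ ⟨a, ha, hva, rfl⟩ ⟨b, hb, hvb, rfl⟩
    exact ⟨a + b, V.add_mem ha hb, v.map_add_le hva hvb, res_add hva hvb⟩
  zero_mem' := ⟨0, V.zero_mem, by simp, res_zero⟩
  smul_mem' := by
    rintro z _ ⟨a, ha, hva, rfl⟩
    obtain ⟨c, hc, h⟩ := exists_algebraMap_res_eq z
    refine ⟨algebraMap K L c * a, ?_, ?_, ?_⟩
    · rw [← Algebra.smul_def]; exact V.smul_mem c ha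
    · rw [map_mul]; exact mul_le_one' hc hva
    · rw [res_mul hc hva, h, Algebra.smul_def]

lemma rank_resSubmodule_le (V : Submodule K L) :
    Module.rank (ResField (restr K v)) (resSubmodule v V) ≤ Module.rank K V :=
  rank_le_of_forall_exists_res V _ fun _ hz => hz

lemma IsRationalFunctionField.exists_submodule {n : ℕ} (h : IsRationalFunctionField K L n) :
    ∃ V : Submodule K L, Module.rank K V ≤ Cardinal.aleph0 ∧
      ∀ y : L, ∃ a ∈ V, ∃ b ∈ V, b ≠ 0 ∧ y = a / b := by
  obtain ⟨x, -, hg⟩ := h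
  let φ := (MvPolynomial.aeval (R := K) x).toLinearMap
  have hV : ∀ p, MvPolynomial.aeval x p ∈ LinearMap.range φ := fun p => ⟨p, rfl⟩
  refine ⟨LinearMap.range φ, ?_, fun y => ?_⟩
  · have h1 := lift_rank_range_le φ
    have h2 : Module.rank K (MvPolynomial (Fin n) K) ≤ Cardinal.aleph0 := by
      rw [MvPolynomial.rank_eq_lift, ← Cardinal.lift_aleph0.{u, 0}, Cardinal.lift_le]
      exact Cardinal.mk_le_aleph0
    rw [← Cardinal.lift_le.{u}, Cardinal.lift_aleph0]
    refine h1.trans ?_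
    rw [← Cardinal.lift_aleph0.{w, u}, Cardinal.lift_le]
    exact h2
  · have hy : y ∈ IntermediateField.adjoin K (Set.range x) := by rw [hg]; trivial
    obtain ⟨p, q, rfl⟩ := (IntermediateField.mem_adjoin_range_iff K x y).1 hy
    by_cases hq : MvPolynomial.aeval x q = 0
    · exact ⟨_, hV 0, _, hV 1, by simp, by simp [hq]⟩
    · exact ⟨_, hV p, _, hV q, hq, rfl⟩

-- Write a field element as `a / b` with `a`, `b` in the space `V` of polynomials. The values of `V`
-- fall into countably many cosets of `vK`. If `a / b` has value 1, dividing both by a common `c *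
-- r` with `r` in `R` places them in `r⁻¹V`, and the residues from each such space span a space of
-- countable dimension.
variable (v) in
theorem countable_of_isRationalFunctionField {n : ℕ} (h : IsRationalFunctionField K L n) :
    Countable (ValQuot K v) ∧
      IsCountablyGenerated (ResField (restr K v)) (ResField v) := by
  obtain ⟨V, hV, hdiv⟩ := h.exists_submodule
  obtain ⟨R, hRV, hR0, hcard, hR⟩ := exists_set_val_representatives v V
  have hRc : R.Countable := Cardinal.le_aleph0_iff_set_countable.1 (hcard.trans hV)
  constructor
  · refine countable_quotient (values_subset_valGroup (v := v) (S := insert 1 R))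
      (countable_values (hRc.insert 1)) (valGroup_le_sup_closure K hR0 one_ne_zero fun y hy => ?_)
    obtain ⟨a, ha, b, hb, hb0, rfl⟩ := hdiv y
    have ha0 : a ≠ 0 := by rintro rfl; simp at hy
    obtain ⟨r, hr, c, hc⟩ := hR a ha ha0
    obtain ⟨s, hs, d, hd⟩ := hR b hb hb0
    refine ⟨r, hr, s, hs, c / d, 0, ?_⟩
    rw [map_div₀, hc, hd, zpow_zero, mul_one, ← map_div₀, map_div₀ (algebraMap K L)]
    congr 1
    rw [div_mul_div_comm]
  · have hspan : ∀ r : L, ∃ B : Set (ResField v), B.Countable ∧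
        resSubmodule v (V.map (LinearMap.mulLeft K r⁻¹)) ≤
          Submodule.span (ResField (restr K v)) B := fun r =>
      exists_countable_le_span _ ((rank_resSubmodule_le _).trans ((rank_map_le _ V).trans hV))
    choose B hBc hB using hspan
    refine ⟨⋃ r ∈ R, B r, hRc.biUnion fun r _ => hBc r, ?_⟩
    rw [eq_top_iff]
    rintro z -
    obtain ⟨y, hy, rfl⟩ := exists_res_eq z
    rcases hy.lt_or_eq with h1 | h1
    · rw [(res_eq_zero_iff h1.le).2 h1]; exact zero_mem _
    obtain ⟨a, ha, b, hb, hb0, rfl⟩ := hdiv y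
    have ha0 : a ≠ 0 := by rintro rfl; simp at h1
    obtain ⟨r, hr, c, hc⟩ := hR a ha ha0
    have hvb0 : v b ≠ 0 := by simpa using hb0
    have hva0 : v a ≠ 0 := by simpa using ha0
    have hcr : algebraMap K L c * r ≠ 0 := by
      rw [← Valuation.ne_zero_iff v, ← hc]; exact hva0
    have hab : v b = v a := by
      rw [map_div₀, div_eq_one_iff_eq hvb0] at h1; exact h1.symm
    have hmem : ∀ e ∈ V, v e = v a → v (e / (algebraMap K L c * r)) = 1 ∧
        res v (e / (algebraMap K L c * r)) ∈
          IntermediateField.adjoin (ResField (restr K v)) (⋃ r ∈ R, B r) := by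
      intro e he hea
      have hv1 : v (e / (algebraMap K L c * r)) = 1 := by
        rw [map_div₀, hea, ← hc, div_self hva0]
      refine ⟨hv1, ?_⟩
      have h2 : res v (e / (algebraMap K L c * r)) ∈
          resSubmodule v (V.map (LinearMap.mulLeft K r⁻¹)) := by
        refine ⟨_, ⟨c⁻¹ • e, V.smul_mem _ he, ?_⟩, hv1.le, rfl⟩
        rw [LinearMap.mulLeft_apply, Algebra.smul_def, map_inv₀, div_eq_mul_inv, mul_inv]
        ring
      have h3 : Submodule.span (ResField (restr K v)) (B r) ≤ Subalgebra.toSubmodule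
          (IntermediateField.adjoin (ResField (restr K v)) (⋃ r ∈ R, B r)).toSubalgebra := by
        rw [Submodule.span_le]
        exact (Set.subset_biUnion_of_mem hr).trans (IntermediateField.subset_adjoin _ _)
      exact h3 (hB r h2)
    obtain ⟨hva1, hma⟩ := hmem a ha rfl
    obtain ⟨hvb1, hmb⟩ := hmem b hb hab
    have e : a / b = a / (algebraMap K L c * r) * (b / (algebraMap K L c * r))⁻¹ := by
      rw [inv_div, div_mul_div_cancel₀ hcr]
    rw [e, res_mul hva1.le (by rw [map_inv₀, hvb1, inv_one]), res_inv hvb1]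
    exact mul_mem hma (inv_mem hmb)

end Countability

/-! ### Algebraic extensions of valued fields. -/

section Algebraic

variable {K L Γ Γ' : Type*} [Field K] [Field L] [Algebra K L] [LinearOrderedCommGroupWithZero Γ]
  [LinearOrderedCommGroupWithZero Γ'] {vK : Valuation K Γ} {vL : Valuation L Γ'}

/-- A root of a monic lift is integral over the valuation ring, hence lies in it and can be reduced.
-/
lemma isAlgClosed_resField [IsAlgClosed K] (v : Valuation K Γ) : IsAlgClosed (ResField v) := by
  refine IsAlgClosed.of_exists_root _ fun p hp hirr => ?_
  have hlift : p ∈ Polynomial.lifts (IsLocalRing.residue v.valuationSubring) := by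
    rw [Polynomial.lifts_iff_coeff_lifts]
    exact fun n => IsLocalRing.residue_surjective _
  obtain ⟨q, hqp, hdeg, hq⟩ := Polynomial.lifts_and_degree_eq_and_monic hlift hp
  have hq' : (q.map (algebraMap v.valuationSubring K)).degree ≠ 0 := by
    rw [hq.degree_map, hdeg]
    exact (Polynomial.degree_pos_of_irreducible hirr).ne'
  obtain ⟨y, hy⟩ := IsAlgClosed.exists_root _ hq'
  rw [Polynomial.IsRoot, Polynomial.eval_map] at hy
  have hint : IsIntegral v.valuationSubring y := ⟨q, hq, hy⟩
  obtain ⟨z, rfl⟩ := IsIntegrallyClosed.isIntegral_iff.1 hint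
  refine ⟨IsLocalRing.residue _ z, ?_⟩
  rw [← hqp, Polynomial.eval_map, Polynomial.eval₂_hom]
  rw [Polynomial.eval₂_at_apply] at hy
  have : q.eval z = 0 := (FaithfulSMul.algebraMap_injective v.valuationSubring K)
    (by rw [hy, map_zero])
  rw [this, map_zero]

variable [vK.HasExtension vL]

lemma val_algebraMap_le_one {a : K} (h : vK a ≤ 1) : vL (algebraMap K L a) ≤ 1 :=
  (Valuation.HasExtension.val_map_le_one_iff vK vL a).2 h

lemma algebraMap_res_of_hasExtension {a : K} (h : vK a ≤ 1) :
    algebraMap (ResField vK) (ResField vL) (res vK a) = res vL (algebraMap K L a) := by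
  rw [res_of_le h, res_of_le (val_algebraMap_le_one (vL := vL) h)]
  rfl

-- Divide an algebraic equation by its largest coefficient; it then reduces to a nonzero one.
variable (vK vL) in
lemma isAlgebraic_resField [Algebra.IsAlgebraic K L] :
    Algebra.IsAlgebraic (ResField vK) (ResField vL) := by
  refine ⟨fun z => ?_⟩
  obtain ⟨y, hy, rfl⟩ := exists_res_eq z
  obtain ⟨p, hp0, hp⟩ := Algebra.IsAlgebraic.isAlgebraic (R := K) y
  obtain ⟨j, hj, hmax⟩ := p.support.exists_max_image (fun i => vK (p.coeff i))
    (Polynomial.support_nonempty.2 hp0)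
  have hcj : p.coeff j ≠ 0 := Polynomial.mem_support_iff.1 hj
  have hvcj : vK (p.coeff j) ≠ 0 := by simpa using hcj
  have hle : ∀ i ∈ p.support, vK (p.coeff i / p.coeff j) ≤ 1 := fun i hi => by
    rw [map_div₀]; exact div_le_one_of_le₀ (hmax i hi) zero_le
  have hle' : ∀ i ∈ p.support, vL (algebraMap K L (p.coeff i / p.coeff j)) ≤ 1 :=
    fun i hi => val_algebraMap_le_one (vK := vK) (hle i hi)
  refine ⟨∑ i ∈ p.support, Polynomial.monomial i (res vK (p.coeff i / p.coeff j)), ?_, ?_⟩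
  · intro h0
    have := congrArg (fun q => Polynomial.coeff q j) h0
    simp only [Polynomial.finsetSum_coeff, Polynomial.coeff_monomial,
      Polynomial.coeff_zero] at this
    rw [Finset.sum_ite_eq' p.support j, if_pos hj, div_self hcj, res_one] at this
    exact one_ne_zero this
  · rw [map_sum]
    have h1 : ∑ i ∈ p.support, algebraMap K L (p.coeff i / p.coeff j) * y ^ i = 0 := by
      have : ∀ i, algebraMap K L (p.coeff i / p.coeff j) * y ^ i =
          (algebraMap K L (p.coeff j))⁻¹ * (algebraMap K L (p.coeff i) * y ^ i) := fun i => by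
        rw [map_div₀]; ring
      simp only [this]
      rw [← Finset.mul_sum]
      rw [Polynomial.aeval_def, Polynomial.eval₂_eq_sum, Polynomial.sum] at hp
      rw [hp, mul_zero]
    have h2 : ∀ i ∈ p.support, vL (algebraMap K L (p.coeff i / p.coeff j) * y ^ i) ≤ 1 :=
      fun i hi => by
        rw [map_mul, map_pow]; exact mul_le_one' (hle' i hi) (pow_le_one' hy i)
    rw [← res_zero (v := vL), ← h1, res_sum _ h2]
    refine Finset.sum_congr rfl fun i hi => ?_
    rw [Polynomial.aeval_monomial, algebraMap_res_of_hasExtension (hle i hi),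
      res_mul (hle' i hi) (by rw [map_pow]; exact pow_le_one' hy i), res_pow hy]

-- Two terms of an algebraic equation for `y` must have the same value, since otherwise the largest
-- could not cancel; comparing them gives the power.
variable (K) in
lemma exists_val_pow_eq_of_isAlgebraic {y : L} (hy0 : y ≠ 0) (hy : IsAlgebraic K y)
    (v : Valuation L Γ') :
    ∃ e : ℕ, 0 < e ∧ ∃ c : K, v (y ^ e * algebraMap K L c) = 1 := by
  classical
  obtain ⟨p, hp0, hp⟩ := hy
  have hvy : v y ≠ 0 := by simpa using hy0
  have hv0 : ∀ i ∈ p.support, v (algebraMap K L (p.coeff i)) ≠ 0 := fun i hi => by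
    simpa using Polynomial.mem_support_iff.1 hi
  have key : ∃ i ∈ p.support, ∃ j ∈ p.support, i < j ∧
      v (algebraMap K L (p.coeff i) * y ^ i) = v (algebraMap K L (p.coeff j) * y ^ j) := by
    by_contra! hne
    have hne' : ∀ i ∈ p.support, ∀ j ∈ p.support, i ≠ j →
        v (algebraMap K L (p.coeff i) * y ^ i) ≠ v (algebraMap K L (p.coeff j) * y ^ j) := by
      intro i hi j hj hij
      rcases lt_or_gt_of_ne hij with h | h
      · exact hne i hi j hj h
      · exact (hne j hj i hi h).symm
    obtain ⟨j, hj, hmax⟩ := p.support.exists_max_image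
      (fun i => v (algebraMap K L (p.coeff i) * y ^ i)) (Polynomial.support_nonempty.2 hp0)
    have hj0 : v (algebraMap K L (p.coeff j) * y ^ j) ≠ 0 := by
      rw [map_mul, map_pow]; exact mul_ne_zero (hv0 j hj) (pow_ne_zero _ hvy)
    rw [Polynomial.aeval_def, Polynomial.eval₂_eq_sum, Polynomial.sum,
      ← Finset.add_sum_erase _ _ hj] at hp
    have hlt : v (∑ i ∈ p.support.erase j, algebraMap K L (p.coeff i) * y ^ i) <
        v (algebraMap K L (p.coeff j) * y ^ j) := by
      refine v.map_sum_lt hj0 fun i hi => ?_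
      have hi' := Finset.mem_of_mem_erase hi
      exact (hmax i hi').lt_of_ne (hne' i hi' j hj (Finset.ne_of_mem_erase hi))
    rw [eq_neg_of_add_eq_zero_left hp, Valuation.map_neg] at hlt
    exact lt_irrefl _ hlt
  obtain ⟨i, hi, j, hj, hij, h⟩ := key
  refine ⟨j - i, by omega, p.coeff j / p.coeff i, ?_⟩
  have hpow : v y ^ j = v y ^ (j - i) * v y ^ i := by rw [← pow_add]; congr 1; omega
  rw [map_mul, map_mul, map_pow, map_pow, hpow, ← mul_assoc] at h
  have h' := mul_right_cancel₀ (pow_ne_zero _ hvy) h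
  rw [map_mul, map_pow, map_div₀, map_div₀, mul_div_assoc', mul_comm, ← h', div_self (hv0 i hi)]

end Algebraic

/-! ### Approximation from an algebraically closed field. -/

section Immediate

variable {K F Kt M Γ Δ Λ : Type*} [Field K] [Field F] [Field Kt] [Field M] [Algebra K F]
  [Algebra K Kt] [Algebra F M] [Algebra Kt M] [Algebra K M] [IsScalarTower K F M]
  [IsScalarTower K Kt M] [LinearOrderedCommGroupWithZero Γ] [LinearOrderedCommGroupWithZero Δ]
  [LinearOrderedCommGroupWithZero Λ] (v : Valuation F Γ) (vt : Valuation Kt Δ)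
  (w : Valuation M Λ)

/-- Divisibility of the value group of `Kt` allows scaling `y` to value 1 by some `b`. The residue
is then algebraic over the algebraically closed residue field of `vt`, so it is the residue of some
`d`, and `d / b` has the leading term of `y`. -/
lemma exists_sub_lt_of_isAlgClosed [v.HasExtension w] [vt.HasExtension w]
    [(restr K v).HasExtension vt] [IsAlgClosed Kt] [Algebra.IsAlgebraic F M]
    (hρ : ∀ y : F, y ≠ 0 → ∃ e : ℕ, 0 < e ∧ ∃ c : K, v (y ^ e * algebraMap K F c) = 1)
    (hτ : Algebra.IsAlgebraic (ResField (restr K v)) (ResField v)) {y : M} (hy : y ≠ 0) :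
    ∃ b : Kt, w (y - algebraMap Kt M b) < w y := by
  have hvy : w y ≠ 0 := by simpa using hy
  have hval : ∃ b : Kt, w (y * algebraMap Kt M b) = 1 := by
    obtain ⟨e, he, f, hf⟩ := exists_val_pow_eq_of_isAlgebraic F hy
      (Algebra.IsAlgebraic.isAlgebraic y) w
    have hf0 : f ≠ 0 := by rintro rfl; simp at hf
    obtain ⟨e', he', c, hc⟩ := hρ f hf0
    rw [← Valuation.HasExtension.val_map_eq_one_iff v w] at hc
    -- The two relations give `y ^ (e * e')` the value of `c`, whence a root of `c⁻¹`.
    obtain ⟨b, hb⟩ := IsAlgClosed.exists_pow_nat_eq (algebraMap K Kt c)⁻¹ (Nat.mul_pos he he')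
    refine ⟨b, ?_⟩
    refine ((pow_eq_one_iff).1 (?_ : w (y * algebraMap Kt M b) ^ (e * e') = 1)).resolve_right
      (Nat.mul_pos he he').ne'
    rw [← map_pow, mul_pow, ← map_pow, hb,
      map_inv₀, ← IsScalarTower.algebraMap_apply, map_mul, map_inv₀]
    rw [map_mul, map_pow, ← IsScalarTower.algebraMap_apply, map_mul, map_pow] at hc
    rw [map_mul, map_pow] at hf
    rw [eq_inv_of_mul_eq_one_right hc, inv_inv, map_pow, pow_mul, ← mul_pow, hf, one_pow]
  obtain ⟨b, hb⟩ := hval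
  have hext : (restr K v).HasExtension w := ⟨by
    have h1 : (restr K v).IsEquiv ((w.comap (algebraMap F M)).comap (algebraMap K F)) :=
      Valuation.IsEquiv.comap _ Valuation.HasExtension.val_isEquiv_comap
    rw [← Valuation.comap_comp, ← IsScalarTower.algebraMap_eq] at h1
    exact h1⟩
  have ht1 : IsScalarTower (ResField (restr K v)) (ResField v) (ResField w) := by
    refine IsScalarTower.of_algebraMap_eq fun z => ?_
    obtain ⟨c, hc, rfl⟩ := exists_res_eq z
    rw [algebraMap_res_of_hasExtension hc, algebraMap_res_of_hasExtension hc,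
      algebraMap_res_of_hasExtension (vK := v) (val_algebraMap_le_one (vK := restr K v) hc),
      ← IsScalarTower.algebraMap_apply]
  have ht2 : IsScalarTower (ResField (restr K v)) (ResField vt) (ResField w) := by
    refine IsScalarTower.of_algebraMap_eq fun z => ?_
    obtain ⟨c, hc, rfl⟩ := exists_res_eq z
    rw [algebraMap_res_of_hasExtension hc, algebraMap_res_of_hasExtension hc,
      algebraMap_res_of_hasExtension (vK := vt) (val_algebraMap_le_one (vK := restr K v) hc),
      ← IsScalarTower.algebraMap_apply]
  have ha1 := isAlgebraic_resField v w
  have ha2 : Algebra.IsAlgebraic (ResField (restr K v)) (ResField w) :=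
    Algebra.IsAlgebraic.trans _ (ResField v) _
  have ha3 : Algebra.IsAlgebraic (ResField vt) (ResField w) :=
    Algebra.IsAlgebraic.tower_top (K := ResField (restr K v)) _
  have hcl := isAlgClosed_resField vt
  have : Algebra.IsIntegral (ResField vt) (ResField w) := Algebra.isAlgebraic_iff_isIntegral.1 ha3
  obtain ⟨z, hz⟩ := (IsAlgClosed.algebraMap_bijective_of_isIntegral (k := ResField vt)
    (K := ResField w)).2 (res w (y * algebraMap Kt M b))
  obtain ⟨d, hd, rfl⟩ := exists_res_eq z
  have hd' := val_algebraMap_le_one (vL := w) hd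
  rw [algebraMap_res_of_hasExtension hd, eq_comm, res_eq_iff hb.le hd'] at hz
  have hb0 : algebraMap Kt M b ≠ 0 := by rintro h0; simp [h0] at hb
  have hvb : 0 < w (algebraMap Kt M b) := zero_lt_iff.2 ((Valuation.ne_zero_iff w).2 hb0)
  refine ⟨d / b, ?_⟩
  have e : y * algebraMap Kt M b - algebraMap Kt M d =
      (y - algebraMap Kt M (d / b)) * algebraMap Kt M b := by
    rw [map_div₀, sub_mul, div_mul_cancel₀ _ hb0]
  rw [e, ← hb, map_mul, map_mul] at hz
  exact lt_of_mul_lt_mul_right hz hvb.le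

end Immediate

/-! ### Moving the valuation into the given value group. -/

section Transport

variable {Kt : Type t} {M : Type t} {Δ : Type h} {Λ : Type w} [Field Kt] [Field M] [Algebra Kt M]
  [LinearOrderedCommGroupWithZero Δ] [LinearOrderedCommGroupWithZero Λ]
  (vt : Valuation Kt Δ) (w : Valuation M Λ) [vt.HasExtension w]

/-- The auxiliary `w` takes values in an unrelated group. Each of them is attained on `Kt`, so `w`
can be replaced by the `vt`-value of an element of `Kt` with the same `w`-value, which restricts to
`vt` exactly. -/
lemma exists_isImmediate (hM : ∀ y : M, y ≠ 0 → ∃ b : Kt, w (y - algebraMap Kt M b) < w y) :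
    ∃ vM : Valuation M Δ, restr Kt vM = vt ∧ IsImmediate Kt vM := by
  have hex : ∀ y : M, ∃ b : Kt, w (algebraMap Kt M b) = w y := fun y => by
    by_cases hy : y = 0
    · exact ⟨0, by simp [hy]⟩
    · obtain ⟨b, hb⟩ := hM y hy
      exact ⟨b, (map_eq_of_sub_lt (by rwa [Valuation.map_sub_swap]))⟩
  choose β hβ using hex
  have hle : ∀ {a b : Kt}, w (algebraMap Kt M a) ≤ w (algebraMap Kt M b) ↔ vt a ≤ vt b :=
    Valuation.HasExtension.val_map_le_iff vt w _ _
  have heq : ∀ {a b : Kt}, w (algebraMap Kt M a) = w (algebraMap Kt M b) ↔ vt a = vt b :=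
    Valuation.HasExtension.val_map_eq_iff vt w _ _
  let vM : Valuation M Δ :=
    { toFun := fun y => vt (β y)
      map_zero' := by rw [← map_zero vt]; exact heq.1 (by rw [hβ]; simp)
      map_one' := by rw [← map_one vt]; exact heq.1 (by rw [hβ]; simp)
      map_mul' := fun x y => by
        rw [← map_mul]; exact heq.1 (by rw [hβ, map_mul, map_mul, map_mul, hβ, hβ])
      map_add_le_max' := fun x y => by
        rw [le_max_iff]
        have := w.map_add x y
        rw [le_max_iff] at this
        refine this.imp (fun h => hle.1 ?_) (fun h => hle.1 ?_)
        · rw [hβ, hβ]; exact h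
        · rw [hβ, hβ]; exact h }
  have hvM : ∀ y, vM y = vt (β y) := fun _ => rfl
  have hlt : ∀ {x y : M}, w x < w y → vM x < vM y := fun {x y} h => by
    rw [hvM, hvM, ← not_le, ← hle, hβ, hβ, not_le]; exact h
  have hrestr : restr Kt vM = vt := by
    ext b
    exact heq.1 (hβ _)
  refine ⟨vM, hrestr, le_antisymm (valGroup_restr_le vM Kt) ?_, ?_⟩
  · intro γ hγ
    obtain ⟨y, hy⟩ := (mem_valGroup_iff vM).1 hγ
    refine (mem_valGroup_iff _).2 ⟨β y, ?_⟩
    rw [hrestr]; exact hy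
  · intro z
    obtain ⟨y, hy, rfl⟩ := exists_res_eq z
    rcases hy.lt_or_eq with h1 | h1
    · exact ⟨0, by rw [map_zero, (res_eq_zero_iff hy).2 h1]⟩
    obtain ⟨b, hb⟩ := hM y (by rintro rfl; simp at h1)
    have h2 := hlt hb
    have h3 : vM (algebraMap Kt M b) ≤ 1 := by
      rw [← h1]
      exact (map_eq_of_sub_lt (v := vM) (by rwa [Valuation.map_sub_swap])).le
    refine ⟨res (restr Kt vM) b, ?_⟩
    rw [algebraMap_res h3, eq_comm, res_eq_iff hy h3]
    rwa [h1] at h2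

end Transport

/-! ### Common extensions of two valuations. -/

section Amalgamation

variable {K F Kt M Ω Γ Δ ι : Type*} [Field K] [Field F] [Field Kt] [Field M] [Field Ω]
  [Algebra K F] [Algebra K Kt] [Algebra F M] [Algebra Kt M] [Algebra K M] [IsScalarTower K F M]
  [IsScalarTower K Kt M] [LinearOrderedCommGroupWithZero Γ] [LinearOrderedCommGroupWithZero Δ]
  {v : Valuation F Γ} {vt : Valuation Kt Δ} {α : ResField v →+* Ω} {β : ResField vt →+* Ω}

/-- Linear relations between integral elements of linearly disjoint extensions can be reduced. -/
lemma sum_res_mul_res_eq_zero [(restr K v).HasExtension vt]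
    (hαβ : ∀ c : K, v (algebraMap K F c) ≤ 1 →
      α (res v (algebraMap K F c)) = β (res vt (algebraMap K Kt c))) {b : ι → Kt}
    (s : Finset ι)
    (hdisj : ∀ s' ⊆ s, LinearIndepOn K b s' → LinearIndepOn F (fun i => algebraMap Kt M (b i)) s')
    (hb : ∀ i ∈ s, vt (b i) ≤ 1) {a : ι → F} (ha : ∀ i ∈ s, v (a i) ≤ 1)
    (h0 : ∑ i ∈ s, algebraMap F M (a i) * algebraMap Kt M (b i) = 0) :
    ∑ i ∈ s, α (res v (a i)) * β (res vt (b i)) = 0 := by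
  classical
  induction s using Finset.strongInduction generalizing a with
  | H s ih =>
  -- If the `b i` are independent over `K`, linear disjointness makes all `a i` zero. Otherwise a
  -- relation over `K` is used to eliminate one of them.
  by_cases hs : LinearIndepOn K b s
  · have h1 := hdisj s subset_rfl hs
    rw [linearIndepOn_finset_iff] at h1
    have h2 := h1 a (by simpa only [Algebra.smul_def] using h0)
    exact Finset.sum_eq_zero fun i hi => by rw [h2 i hi, res_zero, map_zero, zero_mul]
  rw [linearIndepOn_finset_iff] at hs
  push Not at hs
  obtain ⟨r, hr, j₀, hj₀, hrj₀⟩ := hs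
  obtain ⟨j, hj, hmax⟩ := s.exists_max_image (fun i => restr K v (r i)) ⟨j₀, hj₀⟩
  have hrj : r j ≠ 0 := by
    intro h
    have h1 := hmax j₀ hj₀
    rw [h, map_zero, le_zero_iff] at h1
    exact hrj₀ ((map_eq_zero _).1 h1)
  -- Dividing by the largest coefficient keeps the relation integral, so it survives reduction, and
  -- makes the coefficient of `b j` equal to 1.
  set q : ι → K := fun i => r i / r j with hq
  have hq1 : q j = 1 := div_self hrj
  have hqle : ∀ i ∈ s, restr K v (q i) ≤ 1 := fun i hi => by
    rw [hq, map_div₀]; exact div_le_one_of_le₀ (hmax i hi) zero_le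
  have hqt : ∀ i ∈ s, vt (algebraMap K Kt (q i)) ≤ 1 := fun i hi =>
    val_algebraMap_le_one (vK := restr K v) (hqle i hi)
  have hqb : ∑ i ∈ s, algebraMap K Kt (q i) * b i = 0 := by
    have : ∀ i, algebraMap K Kt (q i) * b i = (algebraMap K Kt (r j))⁻¹ * (r i • b i) :=
      fun i => by rw [hq, map_div₀, Algebra.smul_def]; ring
    simp only [this]
    rw [← Finset.mul_sum, hr, mul_zero]
  have hresqb : ∑ i ∈ s, β (res vt (algebraMap K Kt (q i))) * β (res vt (b i)) = 0 := by
    have h1 : ∀ i ∈ s, vt (algebraMap K Kt (q i) * b i) ≤ 1 := fun i hi => by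
      rw [map_mul]; exact mul_le_one' (hqt i hi) (hb i hi)
    rw [← map_zero β, ← res_zero (v := vt), ← hqb, res_sum _ h1, map_sum]
    exact Finset.sum_congr rfl fun i hi => by
      rw [res_mul (hqt i hi) (hb i hi), map_mul]
  set a' : ι → F := fun i => a i - a j * algebraMap K F (q i) with ha'
  have hmul : ∀ i ∈ s, v (a j * algebraMap K F (q i)) ≤ 1 := fun i hi => by
    rw [map_mul]; exact mul_le_one' (ha j hj) (hqle i hi)
  have ha'le : ∀ i ∈ s, v (a' i) ≤ 1 := fun i hi =>
    (v.map_sub _ _).trans (max_le (ha i hi) (hmul i hi))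
  have ha'j : a' j = 0 := by simp [ha', hq1]
  have hrel : ∑ i ∈ s, algebraMap F M (a' i) * algebraMap Kt M (b i) = 0 := by
    have : ∀ i, algebraMap F M (a' i) * algebraMap Kt M (b i) =
        algebraMap F M (a i) * algebraMap Kt M (b i) -
          algebraMap F M (a j) * algebraMap Kt M (algebraMap K Kt (q i) * b i) := fun i => by
      rw [ha', map_sub, map_mul, map_mul, ← IsScalarTower.algebraMap_apply K F M,
        ← IsScalarTower.algebraMap_apply K Kt M]
      ring
    simp only [this]
    rw [Finset.sum_sub_distrib, h0, ← Finset.mul_sum, ← map_sum, hqb, map_zero, mul_zero, sub_zero]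
  have hsub := Finset.erase_subset j s
  have key := ih (s.erase j) (Finset.erase_ssubset hj) (fun s' h => hdisj s' (h.trans hsub))
    (fun i hi => hb i (hsub hi)) (a := a') (fun i hi => ha'le i (hsub hi))
    (by rw [Finset.sum_erase _ (by rw [ha'j, map_zero, zero_mul]), hrel])
  rw [Finset.sum_erase _ (by rw [ha'j, res_zero, map_zero, zero_mul])] at key
  have hres : ∀ i ∈ s, α (res v (a' i)) * β (res vt (b i)) = α (res v (a i)) * β (res vt (b i)) -
      α (res v (a j)) * (β (res vt (algebraMap K Kt (q i))) * β (res vt (b i))) := fun i hi => by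
    rw [ha', res_sub (ha i hi) (hmul i hi), res_mul (ha j hj) (hqle i hi), map_sub, map_mul,
      hαβ _ (hqle i hi)]
    ring
  rw [Finset.sum_congr rfl hres, Finset.sum_sub_distrib, ← Finset.mul_sum, hresqb, mul_zero,
    sub_zero] at key
  exact key

/-- The second condition, applied to inverses, gives the converse of the first. -/
lemma hasExtension_of_le_of_lt {Λ : Type*} [LinearOrderedCommGroupWithZero Λ] {w : Valuation M Λ}
    (h1 : ∀ y : F, v y ≤ 1 → w (algebraMap F M y) ≤ 1)
    (h2 : ∀ y : F, v y < 1 → w (algebraMap F M y) < 1) : v.HasExtension w := by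
  refine ⟨Valuation.isEquiv_iff_val_le_one.2 fun {y} => ⟨h1 y, fun h => ?_⟩⟩
  by_contra! hy
  have hy0 : y ≠ 0 := by rintro rfl; simp at hy
  have h3 := h2 y⁻¹ (by rw [map_inv₀]; exact inv_lt_one_of_one_lt₀ hy)
  rw [map_inv₀, map_inv₀, inv_lt_one₀ (zero_lt_iff.2 (by simpa using hy0))] at h3
  exact h3.not_ge h

/-- Two linearly disjoint extensions of a valued field have a common valued extension. -/
lemma exists_valuationSubring_hasExtension {F : Type w} {Kt : Type t} [Field F] [Field Kt]
    [Algebra K F] [Algebra K Kt] [Algebra F M] [Algebra Kt M] [IsScalarTower K F M]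
    [IsScalarTower K Kt M] {v : Valuation F Γ} {vt : Valuation Kt Δ} {α : ResField v →+* Ω}
    {β : ResField vt →+* Ω} [(restr K v).HasExtension vt]
    (hαβ : ∀ c : K, v (algebraMap K F c) ≤ 1 →
      α (res v (algebraMap K F c)) = β (res vt (algebraMap K Kt c)))
    (hdisj : ∀ (ι : Type (max w t)) (b : ι → Kt), LinearIndependent K b →
      LinearIndependent F fun i => algebraMap Kt M (b i)) :
    ∃ B : ValuationSubring M, v.HasExtension B.valuation ∧ vt.HasExtension B.valuation := by
  let R := v.valuationSubring
  let S := vt.valuationSubring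
  let Φ : R ⊗[ℤ] S →+* M := (Algebra.TensorProduct.lift
    ((algebraMap F M).comp (algebraMap R F)).toIntAlgHom
    ((algebraMap Kt M).comp (algebraMap S Kt)).toIntAlgHom fun _ _ => Commute.all _ _).toRingHom
  let Ψ : R ⊗[ℤ] S →+* Ω := (Algebra.TensorProduct.lift
    (α.comp (IsLocalRing.residue R)).toIntAlgHom
    (β.comp (IsLocalRing.residue S)).toIntAlgHom fun _ _ => Commute.all _ _).toRingHom
  have hΦ : ∀ (x : R) (y : S), Φ (x ⊗ₜ y) = algebraMap F M x * algebraMap Kt M y :=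
    fun x y => Algebra.TensorProduct.lift_tmul ..
  have hΨ : ∀ (x : R) (y : S), Ψ (x ⊗ₜ y) = α (res v x) * β (res vt y) := fun x y => by
    rw [res_of_le x.2, res_of_le y.2]
    exact Algebra.TensorProduct.lift_tmul ..
  -- `Φ` multiplies inside `M`, `Ψ` multiplies residues inside `Ω`. This inclusion of kernels says
  -- that reduction is well defined on the ring generated by the two valuation rings; its kernel `I`
  -- is thus proper and lies in the nonunits of some valuation ring of `M`.
  have hker : ∀ z, Φ z = 0 → Ψ z = 0 := by
    intro z hz
    obtain ⟨s, rfl⟩ := TensorProduct.exists_finset z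
    rw [map_sum] at hz ⊢
    simp only [hΦ] at hz
    simp only [hΨ]
    exact sum_res_mul_res_eq_zero (K := K) (M := M) hαβ (b := fun i : R × S => (i.2 : Kt))
      s (fun s' _ h => hdisj _ _ h) (fun i _ => i.2.2) (fun i _ => i.1.2) hz
  let I : Ideal Φ.range := (RingHom.ker Ψ).map Φ.rangeRestrict
  have hI : I ≠ ⊤ := by
    intro h
    rw [Ideal.eq_top_iff_one, Ideal.mem_map_iff_of_surjective _ Φ.rangeRestrict_surjective] at h
    obtain ⟨z, hz, hz1⟩ := h
    have h1 : Φ z = 1 := congrArg Subtype.val hz1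
    have h2 := hker (z - 1) (by rw [map_sub, h1, map_one, sub_self])
    rw [map_sub, (RingHom.mem_ker).1 hz, map_one, zero_sub, neg_eq_zero] at h2
    exact one_ne_zero h2
  obtain ⟨B, hB1, hB2⟩ := Ideal.image_subset_nonunits_valuationSubring I hI
  have hle : ∀ z, B.valuation (Φ z) ≤ 1 := fun z => (B.valuation_le_one_iff _).2 (hB1 ⟨z, rfl⟩)
  have hlt : ∀ z, Ψ z = 0 → B.valuation (Φ z) < 1 := fun z hz =>
    B.mem_nonunits_iff.1
      (hB2 ⟨Φ.rangeRestrict z, Ideal.mem_map_of_mem _ ((RingHom.mem_ker).2 hz), rfl⟩)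
  refine ⟨B, hasExtension_of_le_of_lt (fun y hy => ?_) fun y hy => ?_,
    hasExtension_of_le_of_lt (fun y hy => ?_) fun y hy => ?_⟩
  · simpa [hΦ] using hle ((⟨y, hy⟩ : R) ⊗ₜ 1)
  · simpa [hΦ] using hlt ((⟨y, hy.le⟩ : R) ⊗ₜ 1)
      (by rw [hΨ, (res_eq_zero_iff hy.le).2 hy, map_zero, zero_mul])
  · simpa [hΦ] using hle (1 ⊗ₜ (⟨y, hy⟩ : S))
  · simpa [hΦ] using hlt (1 ⊗ₜ (⟨y, hy.le⟩ : S))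
      (by rw [hΨ, (res_eq_zero_iff hy.le).2 hy, map_zero, mul_zero])

end Amalgamation

/-! ### The compositum of the function field with an algebraic extension of `K`. -/

section Compositum

/-- Clearing denominators gives a relation with polynomial coefficients over `K`; compare the
coefficients of each monomial. -/
lemma linearIndependent_algebraMap_of_isFractionRing {σ K F Kt M ι : Type*} [Field K] [Field F]
    [Field Kt] [Field M] [Algebra K Kt] [Algebra Kt M] [Algebra F M] [Algebra (MvPolynomial σ K) F]
    [IsFractionRing (MvPolynomial σ K) F] [Algebra (MvPolynomial σ Kt) M]
    [IsFractionRing (MvPolynomial σ Kt) M] [IsScalarTower Kt (MvPolynomial σ Kt) M]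
    (h : ∀ p : MvPolynomial σ K, algebraMap F M (algebraMap _ F p) =
      algebraMap (MvPolynomial σ Kt) M (MvPolynomial.map (algebraMap K Kt) p))
    {b : ι → Kt} (hb : LinearIndependent K b) :
    LinearIndependent F fun i => algebraMap Kt M (b i) := by
  let _ : Algebra (MvPolynomial σ K) M :=
    ((algebraMap F M).comp (algebraMap (MvPolynomial σ K) F)).toAlgebra
  have : IsScalarTower (MvPolynomial σ K) F M := .of_algebraMap_eq fun _ => rfl
  rw [← LinearIndependent.iff_fractionRing (MvPolynomial σ K) F, linearIndependent_iff']
  intro s g h0 i hi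
  have h1 : ∀ i, g i • algebraMap Kt M (b i) = algebraMap (MvPolynomial σ Kt) M
      (.C (b i) * MvPolynomial.map (algebraMap K Kt) (g i)) := fun i => by
    rw [Algebra.smul_def, map_mul, ← h, mul_comm,
      IsScalarTower.algebraMap_apply Kt (MvPolynomial σ Kt) M]
    rfl
  simp only [h1] at h0
  rw [← map_sum, ← map_zero (algebraMap (MvPolynomial σ Kt) M)] at h0
  have h2 := IsFractionRing.injective (MvPolynomial σ Kt) M h0
  ext d
  have h3 := congrArg (MvPolynomial.coeff d) h2
  rw [MvPolynomial.coeff_sum] at h3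
  simp only [MvPolynomial.coeff_C_mul, MvPolynomial.coeff_map, MvPolynomial.coeff_zero] at h3
  refine linearIndependent_iff'.1 hb s (fun i => (g i).coeff d) ?_ i hi
  simpa only [Algebra.smul_def, mul_comm] using h3

/-- `M` is the rational function field over `Kt` in the same number of variables, and `F` embeds by
sending its generators to the variables. -/
lemma exists_compositum {K : Type u} {F : Type w} [Field K] [Field F] [Algebra K F] {n : ℕ}
    (hF : IsRationalFunctionField K F n) (Kt : Type t) [Field Kt]
    [Algebra K Kt] [Algebra.IsAlgebraic K Kt] :
    ∃ (M : Type t) (_ : Field M) (_ : Algebra Kt M) (_ : Algebra F M) (_ : Algebra K M),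
      IsScalarTower K F M ∧ IsScalarTower K Kt M ∧ Algebra.IsAlgebraic F M ∧
      Algebra.trdeg Kt M = n ∧ ∀ (ι : Type (max w t)) (b : ι → Kt), LinearIndependent K b →
        LinearIndependent F fun i => algebraMap Kt M (b i) := by
  obtain ⟨x, hx, hg⟩ := hF
  let R := MvPolynomial (Fin n) K
  let S := MvPolynomial (Fin n) Kt
  let M := FractionRing S
  let X : Fin n → M := fun i => algebraMap S M (MvPolynomial.X i)
  have hinjS : Function.Injective (algebraMap S M) := IsFractionRing.injective S M
  have hX : AlgebraicIndependent Kt X :=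
    (MvPolynomial.algebraicIndependent_X (Fin n) Kt).map' (f := IsScalarTower.toAlgHom Kt S M) hinjS
  have haevX : ∀ p : S, MvPolynomial.aeval X p = algebraMap S M p := fun p => by
    have : MvPolynomial.aeval X = IsScalarTower.toAlgHom Kt S M := by
      ext i; rw [MvPolynomial.aeval_X]; rfl
    rw [this]; rfl
  have htr : Algebra.trdeg Kt M = n := by
    refine IsRationalFunctionField.trdeg_eq ⟨X, hX, eq_top_iff.2 fun z _ => ?_⟩
    obtain ⟨p, q, -, rfl⟩ := IsFractionRing.div_surjective (A := S) z
    exact (IntermediateField.mem_adjoin_range_iff _ _ _).2 ⟨p, q, by rw [haevX, haevX]⟩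
  let _ : Algebra R F := (MvPolynomial.aeval x).toAlgebra
  have hR : ∀ p : R, algebraMap R F p = MvPolynomial.aeval x p := fun _ => rfl
  have hRF : FaithfulSMul R F := (faithfulSMul_iff_algebraMap_injective R F).2 hx
  have hfrac : IsFractionRing R F := .of_field _ _ fun z => by
    have hz : z ∈ IntermediateField.adjoin K (Set.range x) := by rw [hg]; trivial
    obtain ⟨p, q, h⟩ := (IntermediateField.mem_adjoin_range_iff _ _ _).1 hz
    exact ⟨p, q, h⟩
  let m : R →+* S := MvPolynomial.map (algebraMap K Kt)
  let f : R →+* M := (algebraMap S M).comp m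
  have hf : Function.Injective f :=
    hinjS.comp (MvPolynomial.map_injective _ (algebraMap K Kt).injective)
  let j : F →+* M := IsFractionRing.lift hf
  have hj : ∀ p : R, j (algebraMap R F p) = f p := IsFractionRing.lift_algebraMap hf
  let _ : Algebra F M := j.toAlgebra
  let _ : Algebra R M := f.toAlgebra
  have hjM : ∀ p : R, algebraMap F M (algebraMap R F p) = f p := hj
  have hRFM : IsScalarTower R F M := .of_algebraMap_eq fun p => (hj p).symm
  have hC : ∀ c : K, algebraMap R F (MvPolynomial.C c) = algebraMap K F c := fun c => by
    rw [hR, MvPolynomial.aeval_C]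
  have hKFM : IsScalarTower K F M := .of_algebraMap_eq fun c => by
    rw [← hC, hjM, IsScalarTower.algebraMap_apply K Kt M, IsScalarTower.algebraMap_apply Kt S M]
    exact congrArg (algebraMap S M) (MvPolynomial.map_C _ _).symm
  refine ⟨M, inferInstance, inferInstance, inferInstance, inferInstance, hKFM, inferInstance,
    ⟨fun z => ?_⟩, htr, fun ι b hb => ?_⟩
  · have halg : ∀ p : S, IsAlgebraic F (algebraMap S M p) := fun p => by
      induction p using MvPolynomial.induction_on with
      | C a =>
        have h1 : IsAlgebraic K (algebraMap Kt M a) :=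
          (Algebra.IsAlgebraic.isAlgebraic a).algebraMap
        exact h1.extendScalars (algebraMap K F).injective
      | add p q hp hq => rw [map_add]; exact hp.add hq
      | mul_X p i hp =>
        rw [map_mul]
        refine hp.mul ?_
        have h1 : algebraMap S M (MvPolynomial.X i) = algebraMap F M (algebraMap R F (.X i)) := by
          rw [hjM]
          exact congrArg (algebraMap S M) (MvPolynomial.map_X _ _).symm
        rw [h1]
        exact isAlgebraic_algebraMap _
    obtain ⟨p, q, -, rfl⟩ := IsFractionRing.div_surjective (A := S) z
    rw [div_eq_mul_inv]
    exact (halg p).mul (halg q).inv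
  · exact linearIndependent_algebraMap_of_isFractionRing hjM hb

end Compositum

/-- If `F | K` is a rational function field in `n` variables with a valuation whose value group is
torsion over that of `K` and whose residue field is algebraic over that of `K`, then every algebraic
closure of `K` has an immediate extension of transcendence degree `n`. -/
theorem exists_isImmediate_trdeg_eq {K : Type u} {F : Type w} {Γ : Type g} [Field K] [Field F]
    [Algebra K F] [LinearOrderedCommGroupWithZero Γ] {n : ℕ} (hF : IsRationalFunctionField K F n)
    (v : Valuation F Γ)
    (hρ : ∀ y : F, y ≠ 0 → ∃ e : ℕ, 0 < e ∧ ∃ c : K, v (y ^ e * algebraMap K F c) = 1)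
    (hτ : Algebra.IsAlgebraic (ResField (restr K v)) (ResField v))
    (Kt : Type t) {Δ : Type h} [Field Kt] [Algebra K Kt] [IsAlgClosure K Kt]
    [LinearOrderedCommGroupWithZero Δ] (vt : Valuation Kt Δ)
    (hvt : (restr K vt).IsEquiv (restr K v)) :
    ∃ (M : Type t) (_ : Field M) (_ : Algebra Kt M) (vM : Valuation M Δ),
      restr Kt vM = vt ∧ IsImmediate Kt vM ∧ Algebra.trdeg Kt M = n := by
  have hcl : IsAlgClosed Kt := IsAlgClosure.isAlgClosed K
  have hext : (restr K v).HasExtension vt := ⟨hvt.symm⟩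
  have halg : Algebra.IsAlgebraic K Kt := IsAlgClosure.isAlgebraic
  obtain ⟨M, _, _, _, _, _, _, _, htr, hdisj⟩ := exists_compositum hF Kt
  let k := ResField (restr K v)
  have hcl' := isAlgClosed_resField vt
  -- As `Fv` is algebraic over `Kv`, it embeds over `Kv` into the residue field of `vt`, which can
  -- therefore serve as the common target `Ω`.
  let α : ResField v →ₐ[k] ResField vt := IsAlgClosed.lift
  obtain ⟨B, hB1, hB2⟩ := exists_valuationSubring_hasExtension (M := M) (α := α.toRingHom)
    (β := RingHom.id _) (v := v) (vt := vt) (fun c hc => by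
      have h1 := algebraMap_res_of_hasExtension (vK := restr K v) (vL := v) hc
      have h2 := algebraMap_res_of_hasExtension (vK := restr K v) (vL := vt) hc
      rw [← h1, RingHom.id_apply, ← h2]
      exact α.commutes _) hdisj
  obtain ⟨vM, h1, h2⟩ := exists_isImmediate vt B.valuation fun y hy =>
    exists_sub_lt_of_isAlgClosed v vt B.valuation hρ hτ hy
  exact ⟨M, inferInstance, inferInstance, vM, h1, h2, htr⟩

end ValuedFunctionField

theorem theorem1p7 {K : Type u} {F : Type w} {Γ : Type g}
    [Field K] [Field F] [Algebra K F] [LinearOrderedCommGroupWithZero Γ]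
    (n : ℕ) (hn : 1 ≤ n) (hF : IsRationalFunctionField K F n) (v : Valuation F Γ) :
    ∃ ρ τ : ℕ,
      rationalRank (ValQuot K v) = (ρ : Cardinal) ∧
      Algebra.trdeg (ResField (restr K v)) (ResField v) = (τ : Cardinal) ∧
      ρ + τ ≤ n ∧
      Countable (ValQuot K v) ∧
      IsCountablyGenerated (ResField (restr K v)) (ResField v) ∧
      (n = ρ + τ →
        Group.FG (ValQuot K v) ∧
        (⊤ : IntermediateField (ResField (restr K v)) (ResField v)).FG ∧
        (IsTrivialOn K v → ρ = 1 →
          IsSimpleAlgebraicOverRational (ResField (restr K v)) (ResField v) τ ∨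
          IsRationalOverFG (ResField (restr K v)) (ResField v) τ) ∧
        (n = τ → IsRationalOverFG (ResField (restr K v)) (ResField v) τ)) ∧
      (ρ = 0 → τ = 0 →
        ∀ (Kt : Type t) (Δ : Type h) [Field Kt] [Algebra K Kt] [IsAlgClosure K Kt]
          [LinearOrderedCommGroupWithZero Δ] (vt : Valuation Kt Δ),
          (restr K vt).IsEquiv (restr K v) →
          ∃ (M : Type t) (_ : Field M) (_ : Algebra Kt M) (vM : Valuation M Δ),
            restr Kt vM = vt ∧ IsImmediate Kt vM ∧
            Algebra.trdeg Kt M = (n : Cardinal)) := by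
  obtain ⟨ρ, τ, hρ, hτ, hle, hab⟩ := abhyankar n hF v
  obtain ⟨hc1, hc2⟩ := countable_of_isRationalFunctionField v hF
  refine ⟨ρ, τ, hρ, hτ, hle, hc1, hc2, fun h => ?_, fun h1 h2 => ?_⟩
  · have H := hab h
    exact ⟨H.valGroup_fg.group_fg, IntermediateField.fg_top_iff.2 H.essFiniteType,
      H.of_rank_one hn, H.of_rank_zero hn⟩
  · intro Kt Δ _ _ _ _ vt hvt
    refine exists_isImmediate_trdeg_eq hF v
      ((rationalRank_valQuot_eq_zero_iff K).1 (by rw [hρ, h1, Nat.cast_zero])) ?_ Kt vt hvt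
    exact trdeg_eq_zero_iff.1 (by rw [hτ, h2, Nat.cast_zero])
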